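/- There are $n \ge 2$ agents with values $v = (v_1,\dots,v_n) \in \mathbb{R}_{\ge 0}^n$. An allocation is a vector $x \in [0,1]^n$, where $x_i$ is the probability that agent $i$ is served; an agent with value $v_i$ who is served with probability $x_i$ and pays $p_i$ in expectation has utility $v_i x_i - p_i$. An environment is given by its set $X$ of feasible allocations: - multi-unit environment with $k$ units: $X$ is the convex hull of the characteristic vectors of the sets of at most $k$ agents; - matroid permutation environment, for a matroid $M$ on the agents: a permutation $\pi$ of the agents is drawn uniformly at random, and then a (possibly random) set from $\{\pi(S) : S \text{ independent in } M\}$ is served; $X$ consists of the resulting vectors of service probabilities (also over the draw of $\pi$); - position environment with weights $1 \ge w_1 \ge \dots \ge w_n \ge 0$: the agents are assigned to the $n$ positions by a random partial assignment (each position goes to at most one agent and each agent gets at most one position), an agent assigned to position $j$ is served with probability $w_j$, and an unassigned agent is not served; $X$ consists of the resulting vectors of service probabilities. An outcome $(x,p)$ with $x \in X$ is envy free for $v$ if $v_i x_i - p_i \ge v_i x_j - p_j$ for all $i,j$, and individually rational if $v_i x_i - p_i \ge 0$ for all $i$. Let $\mathrm{EFO}(v)$ be the supremum of the revenue $\sum_i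 p_i$ over all envy-free, individually rational outcomes, and let $\mathrm{EFO}^{(2)}(v) = \mathrm{EFO}(v_{(2)}, v_{(2)}, v_{(3)}, \dots, v_{(n)})$, where $v_{(1)} \ge v_{(2)} \ge \dots \ge v_{(n)}$ are the values in decreasing order. A (randomized) mechanism maps each reported profile $v$ to a feasible allocation $x(v) \in X$ and payments $p(v)$. It is incentive compatible if $v_i x_i(v) - p_i(v) \ge v_i x_i(z, v_{-i}) - p_i(z, v_{-i})$ for all $v$, $i$ and $z \ge 0$. It is a prior-free $\beta$-approximation to $\mathrm{EFO}^{(2)}$ if $\sum_i p_i(v) \ge \mathrm{EFO}^{(2)}(v)/\beta$ for every profile $v$. **Corollary.** In every multi-unit environment, in every matroid permutation environment and in every position environment there is an incentive-compatible, individually rational mechanism with non-negative payments that is a prior-free $6.24$-approximation to $\mathrm{EFO}^{(2)}$. -/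

import Mathlib

namespace EnvyFree

/-! ### Environments, as sets of feasible allocations

There are `n` agents, indexed by `Fin n`.  An allocation is a vector `x`, where `x i` is the
probability that agent `i` is served. -/

/-- The characteristic vector of a set of agents. -/
def charVec {n : ℕ} (S : Finset (Fin n)) : Fin n → ℝ :=
  fun i => if i ∈ S then 1 else 0

/-- The allocations obtained by serving a random set from the set system `F`. -/
def servingAllocations {n : ℕ} (F : Set (Finset (Fin n))) : Set (Fin n → ℝ) :=
  convexHull ℝ (charVec '' F)

/-- The set system of the environment with `k` identical units and unit-demand agents. -/
def multiUnitSystem (n k : ℕ) : Set (Finset (Fin n)) :=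
  {S | S.card ≤ k}

/-- The set system of a matroid environment: the independent sets.  (Agents that are not in the
ground set of the matroid are never served, just like loops.) -/
def matroidSystem {n : ℕ} (M : Matroid (Fin n)) : Set (Finset (Fin n)) :=
  {S | M.Indep (S : Set (Fin n))}

/-- The set system `F` after renaming the agents by the permutation `π`. -/
def permutedSystem {n : ℕ} (F : Set (Finset (Fin n))) (π : Equiv.Perm (Fin n)) :
    Set (Finset (Fin n)) :=
  {T | ∃ S ∈ F, T = S.map π.toEmbedding}

/-- The allocations of the permutation environment of `F`: a permutation `π` is drawn uniformly
at random, and then a (random) set that is feasible for the permuted system is served. -/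
def permutationAllocations {n : ℕ} (F : Set (Finset (Fin n))) : Set (Fin n → ℝ) :=
  {x | ∃ y : Equiv.Perm (Fin n) → Fin n → ℝ,
    (∀ π, y π ∈ servingAllocations (permutedSystem F π)) ∧
    ∀ i, x i = (∑ π, y π i) / (Nat.factorial n : ℝ)}

/-- The service probabilities under a partial assignment `σ` of agents to positions (each
position is given to at most one agent): an agent assigned to position `j` is served with
probability `w j`, an unassigned agent is not served. -/
def assignmentVec {n : ℕ} (w : Fin n → ℝ) (σ : Fin n ≃. Fin n) : Fin n → ℝ :=
  fun i => (σ i).elim 0 w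

/-- The allocations of the position environment with weights `w`: those induced by random
partial assignments of agents to positions. -/
def positionAllocations {n : ℕ} (w : Fin n → ℝ) : Set (Fin n → ℝ) :=
  convexHull ℝ (Set.range (assignmentVec w))

/-! ### Envy-free outcomes and the benchmark -/

/-- No agent prefers the outcome of another agent. -/
def IsEnvyFree {n : ℕ} (v x p : Fin n → ℝ) : Prop :=
  ∀ i j, v i * x j - p j ≤ v i * x i - p i

/-- No agent has negative utility. -/
def IsIndividuallyRational {n : ℕ} (v x p : Fin n → ℝ) : Prop :=
  ∀ i, 0 ≤ v i * x i - p i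

/-- The revenues of the feasible, individually rational, envy-free outcomes for the profile `v`,
where `X` is the set of feasible allocations. -/
def envyFreeRevenues {n : ℕ} (X : Set (Fin n → ℝ)) (v : Fin n → ℝ) : Set ℝ :=
  {r | ∃ x p : Fin n → ℝ,
    x ∈ X ∧ IsEnvyFree v x p ∧ IsIndividuallyRational v x p ∧ r = ∑ i, p i}

/-- The envy-free optimal revenue. -/
noncomputable def EFO {n : ℕ} (X : Set (Fin n → ℝ)) (v : Fin n → ℝ) : ℝ :=
  sSup (envyFreeRevenues X v)

/-- The supremum in `EFO` is taken over a set that is bounded above. -/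
theorem bddAbove_envyFreeRevenues {n : ℕ} {X : Set (Fin n → ℝ)} {v : Fin n → ℝ}
    (hX : ∀ x ∈ X, ∀ i, x i ≤ 1) (hv : ∀ i, 0 ≤ v i) : BddAbove (envyFreeRevenues X v) := by
  refine ⟨∑ i, v i, ?_⟩
  rintro r ⟨x, p, hx, -, hir, rfl⟩
  refine Finset.sum_le_sum fun i _ => ?_
  have h := mul_le_mul_of_nonneg_left (hX x hx i) (hv i)
  linarith [hir i]

/-- The supremum in `EFO` is taken over a non-empty set. -/
theorem nonempty_envyFreeRevenues {n : ℕ} {X : Set (Fin n → ℝ)} {v : Fin n → ℝ}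
    (hX : (0 : Fin n → ℝ) ∈ X) : (envyFreeRevenues X v).Nonempty :=
  ⟨0, 0, 0, hX, fun i j => by simp, fun i => by simp, by simp⟩

/-- The profile `v` re-indexed in order of decreasing values. -/
noncomputable def sortDecreasing {n : ℕ} (v : Fin n → ℝ) : Fin n → ℝ :=
  v ∘ Tuple.sort (fun i => -v i)

/-- The profile `v⁽²⁾ = (v₂, v₂, v₃, …, vₙ)`, where `v₁ ≥ v₂ ≥ ⋯ ≥ vₙ` are the values of `v` in
decreasing order. -/
noncomputable def secondProfile {n : ℕ} (hn : 2 ≤ n) (v : Fin n → ℝ) : Fin n → ℝ :=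
  fun i => sortDecreasing v (if (i : ℕ) = 0 then ⟨1, hn⟩ else i)

/-- The envy-free benchmark `EFO⁽²⁾`. -/
noncomputable def EFO2 {n : ℕ} (hn : 2 ≤ n) (X : Set (Fin n → ℝ)) (v : Fin n → ℝ) : ℝ :=
  EFO X (secondProfile hn v)

/-! ### Mechanisms -/

/-- A (randomized) mechanism: for each profile of reported values, the probabilities with which
the agents are served and their expected payments. -/
structure Mechanism (n : ℕ) where
  alloc : (Fin n → ℝ) → Fin n → ℝ
  pay : (Fin n → ℝ) → Fin n → ℝ

namespace Mechanism

variable {n : ℕ}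

/-- On each profile the allocation is feasible. -/
def IsFeasible (m : Mechanism n) (X : Set (Fin n → ℝ)) : Prop :=
  ∀ v : Fin n → ℝ, (∀ i, 0 ≤ v i) → m.alloc v ∈ X

/-- No agent gains by reporting a value `z` in place of her true value. -/
def IsIncentiveCompatible (m : Mechanism n) : Prop :=
  ∀ v : Fin n → ℝ, (∀ i, 0 ≤ v i) → ∀ (i : Fin n) (z : ℝ), 0 ≤ z →
    v i * m.alloc (Function.update v i z) i - m.pay (Function.update v i z) i
      ≤ v i * m.alloc v i - m.pay v i

/-- Truthful agents have non-negative utility. -/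
def IsIR (m : Mechanism n) : Prop :=
  ∀ v : Fin n → ℝ, (∀ i, 0 ≤ v i) → IsIndividuallyRational v (m.alloc v) (m.pay v)

/-- Payments are non-negative. -/
def HasNonnegPayments (m : Mechanism n) : Prop :=
  ∀ v : Fin n → ℝ, (∀ i, 0 ≤ v i) → ∀ i, 0 ≤ m.pay v i

/-- The expected revenue on the profile `v`. -/
def revenue (m : Mechanism n) (v : Fin n → ℝ) : ℝ :=
  ∑ i, m.pay v i

end Mechanism

/-- In the environment with feasible allocations `X` there is a prior-free incentive-compatible
`β`-approximation to `EFO⁽²⁾`: one mechanism whose revenue is, on every profile of values, at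
least a `1 / β` fraction of the benchmark on that same profile. -/
def HasPriorFreeApprox {n : ℕ} (hn : 2 ≤ n) (X : Set (Fin n → ℝ)) (β : ℝ) : Prop :=
  ∃ m : Mechanism n, m.IsFeasible X ∧ m.IsIncentiveCompatible ∧ m.IsIR ∧ m.HasNonnegPayments ∧
    ∀ v : Fin n → ℝ, (∀ i, 0 ≤ v i) → EFO2 hn X v ≤ β * m.revenue v

end EnvyFree

namespace EnvyFree

/-! All three environments have the same shape. For a decreasing weight sequence `w` with `w n = 0`,
feasibility means that `x ≥ 0` and every set `S` of agents receives at most the sum of the first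
`#S` weights (`majorizedAllocations`). For matroids the weights are the marginal mean ranks under a
random renaming, decreasing by submodularity. That every majorized vector is feasible follows by
separating hyperplanes, since a linear functional is maximized at a greedy vertex
(`majorizedAllocations_subset`).

Upper bound: let `B` be the concave hull of the single-price revenues of the profile with its top
value lowered to the second. Envy between neighbours in the sorted order bounds the payments, and
Abel summation gives revenue at most `∑ w j * (B (j + 1) - B j) = ∑ (w j - w (j + 1)) * B (j + 1)`
(`IsEnvyFree.sum_pay_le`). The benchmark is thus a mixture of unit-supply problems, with `j + 1`
units having weight `w j - w (j + 1)`.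

Mechanism: use the same mixture. For `k` units, keep the `k` highest bidders, split them by fair
coins, and try to extract from each side the best single-price revenue of the other. The richer side
can always raise the poorer side's revenue, so the smaller of the two is collected
(`min_bestRevenue_le_revenue`), and winners pay critical bids, which makes the mechanism incentive
compatible.

It remains to bound `B k` by 6.24 times the expected smaller revenue. The hull at `k` is at most a
maximum of `a V + (k - a) U`, with `V` and `U` the `a`-th and `k`-th values. Both prices are
available on a split, and the expected smaller side of a fair split is computed for small sets and
extended by superadditivity (`le_subsetMean_split`). The lowered first value makes `a = 1` harmless.
-/

open Finset in
/-- Abel summation against a decreasing non-negative sequence. -/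
theorem sum_mul_nonneg_of_antitone {n : ℕ} {e b : ℕ → ℝ}
    (hb : ∀ j, j + 1 < n → b (j + 1) ≤ b j) (hb0 : ∀ j < n, 0 ≤ b j)
    (he : ∀ m ≤ n, 0 ≤ ∑ j ∈ range m, e j) : 0 ≤ ∑ j ∈ range n, e j * b j := by
  -- The last factor `b m` is the smallest one so far; each step trades `b m` for `b (m + 1)` on a
  -- non-negative prefix sum.
  have key : ∀ m, m < n → b m * ∑ j ∈ range (m + 1), e j ≤ ∑ j ∈ range (m + 1), e j * b j := by
    intro m
    induction m with
    | zero => intro _; simp [mul_comm]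
    | succ m ih =>
      intro hm
      have h1 := ih (by omega)
      have h2 := mul_le_mul_of_nonneg_right (hb m hm) (he (m + 1) (by omega))
      rw [sum_range_succ (fun j => e j * b j), sum_range_succ e (m + 1)]
      linarith
  rcases n with _ | n
  · simp
  · exact (mul_nonneg (hb0 n (by omega)) (he _ le_rfl)).trans (key n (by omega))

/-! ### Majorization and the upper bound on envy-free revenue -/

/-- The allocations that serve each set of agents at most as much as the first positions do. -/
def majorizedAllocations {n : ℕ} (w : ℕ → ℝ) : Set (Fin n → ℝ) :=
  {x | (∀ i, 0 ≤ x i) ∧ ∀ S : Finset (Fin n), ∑ i ∈ S, x i ≤ ∑ j ∈ Finset.range S.card, w j}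

/-- The extension by zero of a vector to a sequence. -/
noncomputable def extendZero {n : ℕ} (x : Fin n → ℝ) (j : ℕ) : ℝ :=
  if h : j < n then x ⟨j, h⟩ else 0

theorem extendZero_of_lt {n : ℕ} (x : Fin n → ℝ) {j : ℕ} (h : j < n) :
    extendZero x j = x ⟨j, h⟩ := by simp [extendZero, h]

theorem extendZero_of_le {n : ℕ} (x : Fin n → ℝ) {j : ℕ} (h : n ≤ j) : extendZero x j = 0 := by
  simp [extendZero, h]

theorem sum_range_extendZero {n : ℕ} (x : Fin n → ℝ) :
    ∑ j ∈ Finset.range n, extendZero x j = ∑ i, x i := by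
  rw [← Fin.sum_univ_eq_sum_range]
  exact Finset.sum_congr rfl fun i _ => by simp [extendZero]

open Finset in
theorem sum_range_extendZero_perm {n : ℕ} (x : Fin n → ℝ) (σ : Equiv.Perm (Fin n)) {m : ℕ}
    (hm : m ≤ n) :
    ∑ j ∈ range m, extendZero (x ∘ σ) j
      = ∑ i ∈ (univ.filter fun j : Fin n => (j : ℕ) < m).map σ.toEmbedding, x i := by
  rw [sum_map]
  refine (sum_bij (fun (a : Fin n) _ => (a : ℕ)) ?_ ?_ ?_ ?_).symm
  · intro a ha; simpa using ha
  · intro a _ b _ h; exact Fin.ext h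
  · intro b hb
    have hb' : b < m := by simpa using hb
    exact ⟨⟨b, by omega⟩, by simpa using hb', rfl⟩
  · intro a _; simp [extendZero]

open Finset in
theorem card_map_perm_initial {n m : ℕ} (σ : Equiv.Perm (Fin n)) (hm : m ≤ n) :
    ((univ.filter fun j : Fin n => (j : ℕ) < m).map σ.toEmbedding).card = m := by
  rw [card_map, Fin.card_filter_val_lt]
  omega

open Finset in
theorem sum_range_extendZero_le {n : ℕ} {w : ℕ → ℝ} {x : Fin n → ℝ}
    (hx : x ∈ majorizedAllocations w) (σ : Equiv.Perm (Fin n)) {m : ℕ} (hm : m ≤ n) :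
    ∑ j ∈ range m, extendZero (x ∘ σ) j ≤ ∑ j ∈ range m, w j := by
  rw [sum_range_extendZero_perm x σ hm]
  have := hx.2 ((univ.filter fun j : Fin n => (j : ℕ) < m).map σ.toEmbedding)
  rwa [card_map_perm_initial σ hm] at this

open Finset in
theorem sum_mul_sub_succ (w c : ℕ → ℝ) (hc : c 0 = 0) (n : ℕ) :
    ∑ j ∈ range n, (w j - w (j + 1)) * c (j + 1)
      = ∑ j ∈ range n, w j * (c (j + 1) - c j) - w n * c n := by
  induction n with
  | zero => simp [hc]
  | succ n ih => rw [sum_range_succ, sum_range_succ, ih]; ring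

/-- The agents can be ordered so that values and envy-free allocations both decrease. -/
theorem IsEnvyFree.exists_perm {n : ℕ} {v x p : Fin n → ℝ} (h : IsEnvyFree v x p) :
    ∃ σ : Equiv.Perm (Fin n), Antitone (v ∘ σ) ∧ Antitone (x ∘ σ) := by
  -- Adding the two envy constraints between `i` and `j` cancels the payments, so values and
  -- allocations are comonotone. Sorting by `v + x` therefore sorts both, ties included.
  have hco : ∀ i j, 0 ≤ (v i - v j) * (x i - x j) := by
    intro i j
    nlinarith [h i j, h j i]
  have hs : Monotone ((fun i => -(v i + x i)) ∘ Tuple.sort fun i => -(v i + x i)) :=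
    Tuple.monotone_sort _
  refine ⟨Tuple.sort fun i => -(v i + x i), fun a b hab => ?_, fun a b hab => ?_⟩ <;>
  · have h1 := hs hab
    simp only [Function.comp] at h1 ⊢
    set i := (Tuple.sort fun i => -(v i + x i)) a
    set j := (Tuple.sort fun i => -(v i + x i)) b
    by_contra hlt
    nlinarith [hco i j]

open Finset in
/-- The revenue of an envy-free outcome is bounded through any concave majorant `B` of the
single-price revenues. -/
theorem IsEnvyFree.sum_pay_le {n : ℕ} {u x p : Fin n → ℝ} {w B : ℕ → ℝ} (hu : Antitone u)
    (hx : x ∈ majorizedAllocations w) (hef : IsEnvyFree u x p)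
    (hir : IsIndividuallyRational u x p) (hB0 : B 0 = 0)
    (hmono : ∀ j < n, B j ≤ B (j + 1))
    (hconc : ∀ j, j + 1 < n → B (j + 2) - B (j + 1) ≤ B (j + 1) - B j)
    (hB : ∀ i : Fin n, ((i : ℕ) + 1 : ℝ) * u i ≤ B (i + 1)) :
    ∑ i, p i ≤ ∑ j ∈ range n, w j * (B (j + 1) - B j) := by
  obtain ⟨σ, hσu, hσx⟩ := hef.exists_perm
  -- `σ` can only permute agents of equal value, because `u` is already sorted.
  have huσ : u ∘ σ = u := by
    have := Tuple.unique_antitone (f := u) (σ := σ) (τ := 1) hσu (by simpa using hu)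
    simpa using this
  set y := extendZero (x ∘ σ) with hy
  set q := extendZero (p ∘ σ) with hq
  set U := extendZero u with hU
  -- Agent `j` does not envy agent `j + 1`; for the last agent the zero extension turns this into
  -- individual rationality.
  have hstep : ∀ j < n, q j ≤ U j * (y j - y (j + 1)) + q (j + 1) := by
    intro j hj
    have huj : u ⟨j, hj⟩ = u (σ ⟨j, hj⟩) := (congrFun huσ _).symm
    rw [hq, hy, hU, extendZero_of_lt _ hj, extendZero_of_lt _ hj, extendZero_of_lt _ hj, huj]
    by_cases hj' : j + 1 < n
    · rw [extendZero_of_lt _ hj', extendZero_of_lt _ hj']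
      have := hef (σ ⟨j, hj⟩) (σ ⟨j + 1, hj'⟩)
      simp only [Function.comp]
      linarith
    · rw [extendZero_of_le _ (by omega), extendZero_of_le _ (by omega)]
      have := hir (σ ⟨j, hj⟩)
      simp only [Function.comp]
      linarith
  have hsum : ∀ m ≤ n, ∑ j ∈ range m, q j
      ≤ ∑ j ∈ range m, ((j : ℝ) + 1) * U j * (y j - y (j + 1)) + m * q m := by
    intro m
    induction m with
    | zero => simp
    | succ m ih =>
      intro hm
      have h1 := ih (by omega)
      have h2 := hstep m (by omega)
      have h3 : (0 : ℝ) ≤ m + 1 := by positivity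
      have h4 := mul_le_mul_of_nonneg_left h2 h3
      rw [sum_range_succ, sum_range_succ]
      push_cast
      linarith
  have hp : ∑ i, p i = ∑ j ∈ range n, q j := by
    rw [hq, sum_range_extendZero]
    exact (Equiv.sum_comp σ p).symm
  have hd : ∀ j < n, 0 ≤ y j - y (j + 1) := by
    intro j hj
    rw [hy, extendZero_of_lt _ hj]
    by_cases hj' : j + 1 < n
    · rw [extendZero_of_lt _ hj']
      exact sub_nonneg.2 (hσx (by simp [Fin.le_def]))
    · rw [extendZero_of_le _ (by omega), sub_zero]
      exact hx.1 _
  have hRB : ∑ j ∈ range n, ((j : ℝ) + 1) * U j * (y j - y (j + 1))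
      ≤ ∑ j ∈ range n, (y j - y (j + 1)) * B (j + 1) := by
    refine sum_le_sum fun j hj => ?_
    have hj' := mem_range.1 hj
    rw [mul_comm]
    refine mul_le_mul_of_nonneg_left ?_ (hd j hj')
    rw [hU, extendZero_of_lt _ hj']
    exact hB ⟨j, hj'⟩
  -- Concavity of `B` makes its increments decrease, so moving from `y` to the majorizing `w` can
  -- only increase the sum.
  have hab : 0 ≤ ∑ j ∈ range n, (w j - y j) * (B (j + 1) - B j) := by
    refine sum_mul_nonneg_of_antitone hconc (fun j hj => sub_nonneg.2 (hmono j hj)) ?_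
    intro m hm
    rw [sum_sub_distrib]
    exact sub_nonneg.2 (sum_range_extendZero_le hx σ hm)
  have h1 := hsum n le_rfl
  have h2 : q n = 0 := extendZero_of_le _ le_rfl
  have h3 : y n = 0 := extendZero_of_le _ le_rfl
  rw [sum_mul_sub_succ y B hB0 n, h3] at hRB
  simp only [sub_mul, sum_sub_distrib] at hab
  rw [h2] at h1
  rw [hp]
  linarith

/-! ### The concave hull of a revenue curve -/

/-- The least line above the points `(l, R l)`, `1 ≤ l ≤ n`, evaluated at `k`: the concave
non-decreasing hull of `R`, with value `0` at `0`. -/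
noncomputable def concaveHull (n : ℕ) (R : ℕ → ℝ) (k : ℕ) : ℝ :=
  if k = 0 then 0 else
    sInf {r | ∃ α β : ℝ, 0 ≤ α ∧ 0 ≤ β ∧ (∀ l, 1 ≤ l → l ≤ n → R l ≤ α + β * l) ∧ r = α + β * k}

theorem concaveHull_le {n : ℕ} {R : ℕ → ℝ} {α β : ℝ} (hα : 0 ≤ α) (hβ : 0 ≤ β)
    (h : ∀ l, 1 ≤ l → l ≤ n → R l ≤ α + β * l) (k : ℕ) : concaveHull n R k ≤ α + β * k := by
  unfold concaveHull
  split_ifs with hk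
  · positivity
  · refine csInf_le ⟨0, ?_⟩ ⟨α, β, hα, hβ, h, rfl⟩
    rintro r ⟨a, b, ha, hb, -, rfl⟩
    positivity

open Finset in
theorem le_concaveHull {n : ℕ} {R : ℕ → ℝ} {k : ℕ} (hk : k ≠ 0) {c : ℝ}
    (h : ∀ α β : ℝ, 0 ≤ α → 0 ≤ β → (∀ l, 1 ≤ l → l ≤ n → R l ≤ α + β * l) → c ≤ α + β * k) :
    c ≤ concaveHull n R k := by
  unfold concaveHull
  rw [if_neg hk]
  -- A horizontal line above all the points shows that the infimum is over a non-empty set.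
  refine le_csInf ⟨_, ∑ l ∈ range (n + 1), |R l|, 0, by positivity, le_rfl, ?_, rfl⟩ ?_
  · intro l _ hl
    have := single_le_sum (f := fun l => |R l|) (fun i _ => abs_nonneg _)
      (mem_range.2 (Nat.lt_succ_of_le hl))
    have h2 := le_abs_self (R l)
    linarith
  · rintro r ⟨α, β, hα, hβ, hl, rfl⟩
    exact h α β hα hβ hl

theorem concaveHull_zero (n : ℕ) (R : ℕ → ℝ) : concaveHull n R 0 = 0 := by simp [concaveHull]

theorem concaveHull_le_succ (n : ℕ) (R : ℕ → ℝ) (k : ℕ) :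
    concaveHull n R k ≤ concaveHull n R (k + 1) := by
  refine le_concaveHull (by omega) fun α β hα hβ h => ?_
  refine (concaveHull_le hα hβ h k).trans ?_
  push_cast
  linarith

/-- An infimum of affine functions is midpoint concave. Resetting the value at `0` to `0` does no
harm: `0` is only an outer point, and the admissible lines have `α ≥ 0`. -/
theorem concaveHull_concave (n : ℕ) (R : ℕ → ℝ) (k : ℕ) :
    concaveHull n R (k + 2) - concaveHull n R (k + 1)
      ≤ concaveHull n R (k + 1) - concaveHull n R k := by
  have : (concaveHull n R (k + 2) + concaveHull n R k) / 2 ≤ concaveHull n R (k + 1) := by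
    refine le_concaveHull (by omega) fun α β hα hβ h => ?_
    have h1 := concaveHull_le hα hβ h k
    have h2 := concaveHull_le hα hβ h (k + 2)
    push_cast at h2 ⊢
    linarith
  linarith

theorem self_le_concaveHull {n : ℕ} (R : ℕ → ℝ) {k : ℕ} (hk : 1 ≤ k) (hkn : k ≤ n) :
    R k ≤ concaveHull n R k :=
  le_concaveHull (by omega) fun _ _ _ _ h => h k hk hkn

/-! ### Mechanisms from monotone winner rules -/

/-- Raising one's own bid never turns a winner into a loser. -/
def IsMonotoneRule {n : ℕ} (W : (Fin n → ℝ) → Finset (Fin n)) : Prop :=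
  ∀ v : Fin n → ℝ, (∀ i, 0 ≤ v i) → ∀ i ∈ W v, ∀ z, v i ≤ z → i ∈ W (Function.update v i z)

/-- The least winning bid of agent `i` against the bids of the others. -/
noncomputable def criticalBid {n : ℕ} (W : (Fin n → ℝ) → Finset (Fin n)) (v : Fin n → ℝ)
    (i : Fin n) : ℝ :=
  sInf {z | 0 ≤ z ∧ i ∈ W (Function.update v i z)}

/-- Draw a winner rule at random, serve the winners, and charge them their critical bids. -/
noncomputable def ruleMechanism {n : ℕ} {ι : Type*} [Fintype ι] (c : ι → ℝ)
    (W : ι → (Fin n → ℝ) → Finset (Fin n)) : Mechanism n where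
  alloc v i := ∑ a, c a * charVec (W a v) i
  pay v i := ∑ a, c a * if i ∈ W a v then criticalBid (W a) v i else 0

section Rule

variable {n : ℕ} {W : (Fin n → ℝ) → Finset (Fin n)} {v : Fin n → ℝ} {i : Fin n}

theorem criticalBid_nonneg : 0 ≤ criticalBid W v i :=
  Real.sInf_nonneg fun _ hz => hz.1

theorem criticalBid_update (z : ℝ) :
    criticalBid W (Function.update v i z) i = criticalBid W v i := by
  simp [criticalBid]

theorem criticalBid_le (hv : ∀ i, 0 ≤ v i) (hi : i ∈ W v) : criticalBid W v i ≤ v i :=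
  csInf_le ⟨0, fun _ hz => hz.1⟩ ⟨hv i, by simpa using hi⟩

theorem le_criticalBid (hv : ∀ i, 0 ≤ v i) (hi : i ∈ W v) {q : ℝ}
    (h : ∀ z, 0 ≤ z → i ∈ W (Function.update v i z) → q ≤ z) : q ≤ criticalBid W v i :=
  le_csInf ⟨v i, hv i, by simpa using hi⟩ fun z hz => h z hz.1 hz.2

/-- A winning bid below `v i` would, by monotonicity, make `v i` win as well. The existence of some
winning bid `z` excludes the default infimum `0` of the empty set. -/
theorem IsMonotoneRule.le_criticalBid_of_notMem (hW : IsMonotoneRule W) (hv : ∀ i, 0 ≤ v i)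
    (hi : i ∉ W v) {z : ℝ} (hz : 0 ≤ z) (hiz : i ∈ W (Function.update v i z)) :
    v i ≤ criticalBid W v i := by
  refine le_csInf ⟨z, hz, hiz⟩ fun y hy => ?_
  by_contra hlt
  have hnn : ∀ j, 0 ≤ Function.update v i y j := by
    intro j
    rcases eq_or_ne j i with rfl | hj
    · simpa using hy.1
    · simpa [hj] using hv j
  have := hW _ hnn i hy.2 (v i) (by simpa using (not_le.1 hlt).le)
  simp at this
  exact hi this

/-- The critical bid does not depend on one's own bid, so it acts as a posted price: truthful
winners value service at no less than it, and losers who could win at no more. -/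
theorem IsMonotoneRule.utility_le (hW : IsMonotoneRule W) (hv : ∀ i, 0 ≤ v i) {z : ℝ}
    (hz : 0 ≤ z) :
    v i * charVec (W (Function.update v i z)) i
        - (if i ∈ W (Function.update v i z) then criticalBid W (Function.update v i z) i else 0)
      ≤ v i * charVec (W v) i - if i ∈ W v then criticalBid W v i else 0 := by
  rw [criticalBid_update]
  unfold charVec
  by_cases h1 : i ∈ W v
  · have := criticalBid_le hv h1
    by_cases h2 : i ∈ W (Function.update v i z) <;> simp [h1, h2, this]
  · by_cases h2 : i ∈ W (Function.update v i z)
    · have := hW.le_criticalBid_of_notMem hv h1 hz h2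
      simp [h1, h2, this]
    · simp [h1, h2]

end Rule

section RuleMechanism

variable {n : ℕ} {ι : Type*} [Fintype ι] {c : ι → ℝ} {W : ι → (Fin n → ℝ) → Finset (Fin n)}

theorem ruleMechanism_utility (u : ℝ) (v : Fin n → ℝ) (i : Fin n) :
    u * (ruleMechanism c W).alloc v i - (ruleMechanism c W).pay v i
      = ∑ a, c a * (u * charVec (W a v) i - if i ∈ W a v then criticalBid (W a) v i else 0) := by
  simp only [ruleMechanism, Finset.mul_sum, ← Finset.sum_sub_distrib]
  exact Finset.sum_congr rfl fun a _ => by ring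

theorem ruleMechanism_isIncentiveCompatible (hc : ∀ a, 0 ≤ c a)
    (hW : ∀ a, IsMonotoneRule (W a)) : (ruleMechanism c W).IsIncentiveCompatible := by
  intro v hv i z hz
  rw [ruleMechanism_utility, ruleMechanism_utility]
  exact Finset.sum_le_sum fun a _ =>
    mul_le_mul_of_nonneg_left ((hW a).utility_le hv hz) (hc a)

theorem ruleMechanism_isIR (hc : ∀ a, 0 ≤ c a) : (ruleMechanism c W).IsIR := by
  intro v hv i
  rw [ruleMechanism_utility]
  refine Finset.sum_nonneg fun a _ => mul_nonneg (hc a) ?_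
  unfold charVec
  by_cases h : i ∈ W a v
  · simpa [h] using criticalBid_le hv h
  · simp [h]

theorem ruleMechanism_hasNonnegPayments (hc : ∀ a, 0 ≤ c a) :
    (ruleMechanism c W).HasNonnegPayments := by
  intro v _ i
  refine Finset.sum_nonneg fun a _ => mul_nonneg (hc a) ?_
  split_ifs
  exacts [criticalBid_nonneg, le_rfl]

theorem ruleMechanism_revenue (v : Fin n → ℝ) :
    (ruleMechanism c W).revenue v = ∑ a, c a * ∑ i ∈ W a v, criticalBid (W a) v i := by
  simp only [Mechanism.revenue, ruleMechanism]
  rw [Finset.sum_comm]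
  refine Finset.sum_congr rfl fun a _ => ?_
  rw [← Finset.mul_sum, Finset.sum_ite_mem, Finset.univ_inter]

end RuleMechanism

/-! ### The agents with the highest bids -/

/-- Agent `j` precedes agent `i` in the order of decreasing bids, ties being broken by name. -/
def Outranks {n : ℕ} (v : Fin n → ℝ) (j i : Fin n) : Prop :=
  v i < v j ∨ v i = v j ∧ j < i

noncomputable instance {n : ℕ} (v : Fin n → ℝ) (j i : Fin n) : Decidable (Outranks v j i) :=
  Classical.propDecidable _

/-- The `k` agents with the highest bids. -/
noncomputable def topAgents {n : ℕ} (k : ℕ) (v : Fin n → ℝ) : Finset (Fin n) :=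
  Finset.univ.filter fun i => (Finset.univ.filter fun j => Outranks v j i).card < k

theorem mem_topAgents {n k : ℕ} {v : Fin n → ℝ} {i : Fin n} :
    i ∈ topAgents k v ↔ (Finset.univ.filter fun j => Outranks v j i).card < k := by
  simp [topAgents]

theorem Outranks.trans {n : ℕ} {v : Fin n → ℝ} {i j l : Fin n} (h1 : Outranks v i j)
    (h2 : Outranks v j l) : Outranks v i l := by
  unfold Outranks at *
  rcases h1 with h1 | ⟨h1, h1'⟩ <;> rcases h2 with h2 | ⟨h2, h2'⟩
  · left; linarith
  · left; linarith
  · left; linarith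
  · right; exact ⟨by linarith, by omega⟩

theorem Outranks.irrefl {n : ℕ} {v : Fin n → ℝ} {i : Fin n} : ¬ Outranks v i i := by
  simp [Outranks]

theorem outranks_or {n : ℕ} (v : Fin n → ℝ) {i j : Fin n} (h : i ≠ j) :
    Outranks v i j ∨ Outranks v j i := by
  unfold Outranks
  rcases lt_trichotomy (v i) (v j) with h1 | h1 | h1
  · exact Or.inr (Or.inl h1)
  · rcases lt_or_gt_of_ne h with h2 | h2
    · exact Or.inl (Or.inr ⟨h1.symm, h2⟩)
    · exact Or.inr (Or.inr ⟨h1, h2⟩)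
  · exact Or.inl (Or.inl h1)

theorem topAgents_mono {n k l : ℕ} (h : k ≤ l) (v : Fin n → ℝ) :
    topAgents k v ⊆ topAgents l v := fun i hi => by
  rw [mem_topAgents] at *
  omega

theorem mem_topAgents_update {n k : ℕ} {v : Fin n → ℝ} {i : Fin n} (hi : i ∈ topAgents k v)
    {z : ℝ} (hz : v i ≤ z) : i ∈ topAgents k (Function.update v i z) := by
  rw [mem_topAgents] at *
  refine (Finset.card_le_card fun j hj => ?_).trans_lt hi
  rcases eq_or_ne j i with rfl | hji
  · simp [Outranks] at hj
  · simp only [Outranks, Finset.mem_filter, Finset.mem_univ, true_and, Function.update_self,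
      Function.update_of_ne hji] at hj
    refine Finset.mem_filter.2 ⟨Finset.mem_univ _, ?_⟩
    rcases hj with hj | ⟨hj, hj'⟩
    · left; linarith
    · rcases hz.lt_or_eq with h | h
      · left; linarith
      · right; exact ⟨by linarith, hj'⟩

/-- Only comparisons with `i` change. The critical case is a `j` that used to outrank `i`: then `j`
and all its old superiors outrank `i`, so they number less than `k`, and exchanging `j` for `i` in
this set covers all new superiors of `j`. -/
theorem topAgents_subset_update {n k : ℕ} {v : Fin n → ℝ} {i : Fin n} {z : ℝ}
    (hi : i ∈ topAgents k v) (hiz : i ∈ topAgents k (Function.update v i z)) :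
    topAgents k v ⊆ topAgents k (Function.update v i z) := by
  intro j hj
  rcases eq_or_ne j i with rfl | hji
  · exact hiz
  rw [mem_topAgents] at *
  have hsame : ∀ l, l ≠ i → (Outranks (Function.update v i z) l j ↔ Outranks v l j) := by
    intro l hl
    simp [Outranks, Function.update_of_ne hl, Function.update_of_ne hji]
  by_cases hij : Outranks v i j
  · refine (Finset.card_le_card fun l hl => ?_).trans_lt hj
    rcases eq_or_ne l i with rfl | hl'
    · simpa using hij
    · simpa [hsame l hl'] using hl
  · have hji' : Outranks v j i := (outranks_or v hji).resolve_right hij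
    calc (Finset.univ.filter fun l => Outranks (Function.update v i z) l j).card
        ≤ (insert i (Finset.univ.filter fun l => Outranks v l j)).card := by
          refine Finset.card_le_card fun l hl => ?_
          rcases eq_or_ne l i with rfl | hl'
          · simp
          · simpa [hsame l hl', hl'] using hl
      _ = (insert j (Finset.univ.filter fun l => Outranks v l j)).card := by
          rw [Finset.card_insert_of_notMem (by simpa using hij),
            Finset.card_insert_of_notMem (by simp [Outranks.irrefl])]
      _ ≤ (Finset.univ.filter fun l => Outranks v l i).card := by
          refine Finset.card_le_card fun l hl => ?_
          rcases Finset.mem_insert.1 hl with rfl | hl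
          · simpa using hji'
          · simpa using (Finset.mem_filter.1 hl).2.trans hji'
      _ < k := hi

/-- The other highest bidders do not depend on the bid of a high bidder. -/
theorem topAgents_update {n k : ℕ} {v : Fin n → ℝ} {i : Fin n} {z : ℝ}
    (hi : i ∈ topAgents k v) (hiz : i ∈ topAgents k (Function.update v i z)) :
    topAgents k (Function.update v i z) = topAgents k v := by
  refine (topAgents_subset_update hi hiz).antisymm' ?_
  have := topAgents_subset_update (z := v i) hiz (by simpa using hi)
  simpa using this

/-- `Tuple.sort` breaks ties by index, exactly as `Outranks` does. -/
theorem outranks_sort_iff {n : ℕ} (v : Fin n → ℝ) (a b : Fin n) :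
    Outranks v (Tuple.sort (fun i => -v i) a) (Tuple.sort (fun i => -v i) b) ↔ a < b := by
  set σ := Tuple.sort fun i => -v i with hσ
  obtain ⟨h1, h2⟩ := Tuple.eq_sort_iff.1 hσ
  have key : ∀ a b : Fin n, a < b → Outranks v (σ a) (σ b) := by
    intro a b hab
    have h3 := h1 hab.le
    simp only [Function.comp] at h3
    rcases h3.lt_or_eq with h4 | h4
    · left; linarith
    · right; exact ⟨by linarith, h2 a b hab h4⟩
  refine ⟨fun h => ?_, key a b⟩
  by_contra hlt
  rcases (not_lt.1 hlt).lt_or_eq with h3 | rfl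
  · exact Outranks.irrefl (h.trans (key b a h3))
  · exact Outranks.irrefl h

theorem sort_mem_topAgents {n : ℕ} (v : Fin n → ℝ) (k : ℕ) (b : Fin n) :
    Tuple.sort (fun i => -v i) b ∈ topAgents k v ↔ (b : ℕ) < k := by
  rw [mem_topAgents]
  have : (Finset.univ.filter fun j => Outranks v j (Tuple.sort (fun i => -v i) b))
      = (Finset.univ.filter fun a => a < b).map (Tuple.sort fun i => -v i).toEmbedding := by
    ext j
    obtain ⟨a, rfl⟩ := (Tuple.sort fun i => -v i).surjective j
    simp [outranks_sort_iff]
  rw [this, Finset.card_map]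
  have h2 : (Finset.univ.filter fun a : Fin n => a < b) = Finset.Iio b := by ext; simp
  rw [h2, Fin.card_Iio]

theorem topAgents_eq_map {n : ℕ} (v : Fin n → ℝ) (k : ℕ) :
    topAgents k v = (Finset.univ.filter fun j : Fin n => (j : ℕ) < k).map
      (Tuple.sort fun i => -v i).toEmbedding := by
  ext j
  obtain ⟨a, rfl⟩ := (Tuple.sort fun i => -v i).surjective j
  simp [sort_mem_topAgents]

theorem card_topAgents {n k : ℕ} (hk : k ≤ n) (v : Fin n → ℝ) : (topAgents k v).card = k := by
  rw [topAgents_eq_map, card_map_perm_initial _ hk]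

theorem sortDecreasing_antitone {n : ℕ} (v : Fin n → ℝ) : Antitone (sortDecreasing v) := by
  intro a b hab
  have := Tuple.monotone_sort (fun i => -v i) hab
  simp only [Function.comp] at this
  simpa [sortDecreasing] using this

theorem sortDecreasing_le_of_mem_topAgents {n a : ℕ} (ha : a < n) {v : Fin n → ℝ} {i : Fin n}
    (hi : i ∈ topAgents (a + 1) v) : sortDecreasing v ⟨a, ha⟩ ≤ v i := by
  obtain ⟨b, rfl⟩ := (Tuple.sort fun i => -v i).surjective i
  rw [sort_mem_topAgents] at hi
  exact sortDecreasing_antitone v (show b ≤ ⟨a, ha⟩ by simp [Fin.le_def]; omega)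

/-! ### Random sampling profit extraction among the highest bidders -/

open Finset in
/-- The best revenue from offering one price to the agents in `S`. -/
noncomputable def bestRevenue {n : ℕ} (v : Fin n → ℝ) (S : Finset (Fin n)) : ℝ :=
  ⨆ j : S, v j * #{l ∈ S | v j ≤ v l}

open Finset Classical in
/-- The winners when the agents in `S` share the cost `r`: the largest set of agents who can all
pay the same share. -/
noncomputable def costShareWinners {n : ℕ} (v : Fin n → ℝ) (S : Finset (Fin n)) (r : ℝ) :
    Finset (Fin n) :=
  {i ∈ S | ∃ m : ℕ, 1 ≤ m ∧ r ≤ m * v i ∧ m ≤ #{j ∈ S | r ≤ m * v j}}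

/-- The `k` highest bidders are split into the sides `A` and `Aᶜ`, and from each side one extracts
the best single-price revenue of the other side. -/
noncomputable def samplingWinners {n : ℕ} (k : ℕ) (A : Finset (Fin n)) (v : Fin n → ℝ) :
    Finset (Fin n) :=
  costShareWinners v (topAgents k v ∩ A) (bestRevenue v (topAgents k v ∩ Aᶜ)) ∪
    costShareWinners v (topAgents k v ∩ Aᶜ) (bestRevenue v (topAgents k v ∩ A))

section

variable {n k : ℕ} {v : Fin n → ℝ} {A S : Finset (Fin n)} {r : ℝ} {i : Fin n}

theorem bestRevenue_congr {v' : Fin n → ℝ} (h : ∀ j ∈ S, v j = v' j) :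
    bestRevenue v S = bestRevenue v' S := by
  unfold bestRevenue
  congr 1
  ext j
  rw [h j j.2]
  congr 3
  exact Finset.filter_congr fun l hl => by rw [h l hl]

theorem bestRevenue_update (hi : i ∉ S) (z : ℝ) :
    bestRevenue (Function.update v i z) S = bestRevenue v S :=
  bestRevenue_congr fun _ hj => Function.update_of_ne (ne_of_mem_of_not_mem hj hi) _ _

theorem bestRevenue_nonneg (hv : ∀ i, 0 ≤ v i) : 0 ≤ bestRevenue v S :=
  Real.iSup_nonneg fun _ => mul_nonneg (hv _) (Nat.cast_nonneg _)

open Finset in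
-- Raising the price `p` to the least value that is at least `p` keeps all buyers.
theorem mul_card_le_bestRevenue (hv : ∀ i, 0 ≤ v i) (p : ℝ) :
    p * #{l ∈ S | p ≤ v l} ≤ bestRevenue v S := by
  rcases ({l ∈ S | p ≤ v l}).eq_empty_or_nonempty with h | h
  · simpa [h] using bestRevenue_nonneg hv
  · obtain ⟨j, hj, hmin⟩ := exists_min_image _ v h
    obtain ⟨hjS, hjp⟩ := mem_filter.1 hj
    have h1 : ({l ∈ S | p ≤ v l}) = {l ∈ S | v j ≤ v l} := by
      ext l
      simp only [mem_filter, and_congr_right_iff]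
      exact fun hl => ⟨fun h => hmin l (mem_filter.2 ⟨hl, h⟩), hjp.trans⟩
    calc p * #{l ∈ S | p ≤ v l} ≤ v j * #{l ∈ S | v j ≤ v l} := by
          rw [h1]; exact mul_le_mul_of_nonneg_right hjp (Nat.cast_nonneg _)
      _ ≤ bestRevenue v S :=
          le_ciSup (f := fun j : S => v j * (#{l ∈ S | v j ≤ v l} : ℝ))
            (Set.finite_range _).bddAbove ⟨j, hjS⟩

open Finset in
-- Take `m` to be the number of buyers at the optimal price; each of them can pay that price, hence
-- also `r / m`.
theorem exists_share_of_le_bestRevenue (hr : 0 < r) (h : r ≤ bestRevenue v S) :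
    ∃ m : ℕ, 1 ≤ m ∧ m ≤ #{j ∈ S | r ≤ m * v j} := by
  have hS : S.Nonempty := by
    rw [nonempty_iff_ne_empty]
    rintro rfl
    simp [bestRevenue] at h
    linarith
  have : Nonempty S := hS.to_subtype
  obtain ⟨j, hj⟩ := exists_eq_ciSup_of_finite (f := fun j : S => v j * (#{l ∈ S | v j ≤ v l} : ℝ))
  have hj' : r ≤ v j * #{l ∈ S | v j ≤ v l} := by
    rw [hj]; exact h
  refine ⟨#{l ∈ S | v j ≤ v l}, card_pos.2 ⟨j, by simp⟩, card_le_card fun l hl => ?_⟩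
  obtain ⟨h1, h2⟩ := mem_filter.1 hl
  refine mem_filter.2 ⟨h1, hj'.trans ?_⟩
  rw [mul_comm]
  exact mul_le_mul_of_nonneg_left h2 (Nat.cast_nonneg _)

open Finset in
theorem mem_costShareWinners : i ∈ costShareWinners v S r ↔
    i ∈ S ∧ ∃ m : ℕ, 1 ≤ m ∧ r ≤ m * v i ∧ m ≤ #{j ∈ S | r ≤ m * v j} := by
  simp [costShareWinners]

theorem costShareWinners_subset : costShareWinners v S r ⊆ S :=
  fun _ h => (mem_costShareWinners.1 h).1

open Finset in
theorem mem_costShareWinners_update (hi : i ∈ costShareWinners v S r) {z : ℝ} (hz : v i ≤ z) :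
    i ∈ costShareWinners (Function.update v i z) S r := by
  obtain ⟨hiS, m, hm, h1, h2⟩ := mem_costShareWinners.1 hi
  have hle : ∀ j, v j ≤ Function.update v i z j := by
    intro j
    rcases eq_or_ne j i with rfl | hj
    · simpa using hz
    · simp [hj]
  refine mem_costShareWinners.2 ⟨hiS, m, hm, h1.trans ?_, h2.trans (card_le_card fun j hj => ?_)⟩
  · exact mul_le_mul_of_nonneg_left (hle i) (Nat.cast_nonneg _)
  · obtain ⟨h3, h4⟩ := mem_filter.1 hj
    exact mem_filter.2 ⟨h3, h4.trans (mul_le_mul_of_nonneg_left (hle j) (Nat.cast_nonneg _))⟩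

open Finset in
/-- The winners of the cost sharing number at least `m` for some `m`, and none of them could win
with a bid below the share `r / m`. -/
theorem exists_share (hv : ∀ i, 0 ≤ v i)
    (h : ∃ m : ℕ, 1 ≤ m ∧ m ≤ #{j ∈ S | r ≤ m * v j}) :
    ∃ m : ℕ, 1 ≤ m ∧ m ≤ #(costShareWinners v S r) ∧
      ∀ i ∈ costShareWinners v S r, ∀ z, 0 ≤ z →
        i ∈ costShareWinners (Function.update v i z) S r → r ≤ m * z := by
  classical
  set P : ℕ → Prop := fun m => 1 ≤ m ∧ m ≤ #{j ∈ S | r ≤ m * v j} with hP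
  obtain ⟨m₀, hm₀⟩ := h
  have hbound : ∀ m, P m → m ≤ #S := fun m hm => hm.2.trans (card_filter_le _ _)
  -- The largest sustainable coalition size, that is, the lowest share. If `i` won with `z < r / m`,
  -- it would do so through a size `q > m`. Since `i` already wins truthfully through some `l ≤ m`,
  -- it can afford `r / q` at `v i` too, so `q` would be sustainable in `v`.
  set m := Nat.findGreatest P #S with hm
  have hPm : P m := Nat.findGreatest_spec (hbound m₀ hm₀) hm₀
  have hmax : ∀ l, P l → l ≤ m := fun l hl => Nat.le_findGreatest (hbound l hl) hl
  refine ⟨m, hPm.1, hPm.2.trans (card_le_card fun j hj => ?_), ?_⟩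
  · obtain ⟨h1, h2⟩ := mem_filter.1 hj
    exact mem_costShareWinners.2 ⟨h1, m, hPm.1, h2, hPm.2⟩
  · intro i hi z hz hiz
    obtain ⟨hiS, l, hl1, hl2, hl3⟩ := mem_costShareWinners.1 hi
    obtain ⟨-, q, hq1, hq2, hq3⟩ := mem_costShareWinners.1 hiz
    rw [Function.update_self] at hq2
    by_contra hlt
    have hmq : m < q := by
      by_contra hle
      have : (q : ℝ) ≤ m := by exact_mod_cast not_lt.1 hle
      exact hlt (hq2.trans (mul_le_mul_of_nonneg_right this hz))
    have hlm : l ≤ m := hmax l ⟨hl1, hl3⟩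
    have hlq : (l : ℝ) ≤ q := by exact_mod_cast hlm.trans hmq.le
    refine absurd (hmax q ⟨hq1, hq3.trans (card_le_card fun j hj => ?_)⟩) (by omega)
    obtain ⟨h1, h2⟩ := mem_filter.1 hj
    refine mem_filter.2 ⟨h1, ?_⟩
    rcases eq_or_ne j i with rfl | hji
    · exact hl2.trans (mul_le_mul_of_nonneg_right hlq (hv _))
    · rwa [Function.update_of_ne hji] at h2

theorem samplingWinners_subset : samplingWinners k A v ⊆ topAgents k v :=
  Finset.union_subset (costShareWinners_subset.trans Finset.inter_subset_left)
    (costShareWinners_subset.trans Finset.inter_subset_left)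

theorem samplingWinners_compl : samplingWinners k Aᶜ v = samplingWinners k A v := by
  simp only [samplingWinners, compl_compl]
  rw [Finset.union_comm]

theorem mem_samplingWinners_of_mem (hiA : i ∈ A) :
    i ∈ samplingWinners k A v ↔
      i ∈ costShareWinners v (topAgents k v ∩ A) (bestRevenue v (topAgents k v ∩ Aᶜ)) := by
  unfold samplingWinners
  rw [Finset.mem_union, or_iff_left]
  intro h
  have := costShareWinners_subset h
  simp [hiA] at this

theorem mem_samplingWinners_update_of_mem (hiA : i ∈ A) {z : ℝ} (hi : i ∈ topAgents k v)
    (hiz : i ∈ topAgents k (Function.update v i z)) :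
    i ∈ samplingWinners k A (Function.update v i z) ↔
      i ∈ costShareWinners (Function.update v i z) (topAgents k v ∩ A)
        (bestRevenue v (topAgents k v ∩ Aᶜ)) := by
  rw [mem_samplingWinners_of_mem hiA, topAgents_update hi hiz, bestRevenue_update (by simp [hiA])]

/-- A raised winning bid leaves the top `k` unchanged, hence also the bidder's side and the target
from the other side; the cost sharing itself is monotone. -/
theorem samplingWinners_isMonotoneRule (k : ℕ) (A : Finset (Fin n)) :
    IsMonotoneRule (samplingWinners k A) := by
  have key : ∀ (A : Finset (Fin n)) (v : Fin n → ℝ), ∀ i ∈ samplingWinners k A v, i ∈ A →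
      ∀ z, v i ≤ z → i ∈ samplingWinners k A (Function.update v i z) := by
    intro A v i hi hiA z hz
    have hT := samplingWinners_subset hi
    rw [mem_samplingWinners_update_of_mem hiA hT (mem_topAgents_update hT hz)]
    exact mem_costShareWinners_update ((mem_samplingWinners_of_mem hiA).1 hi) hz
  intro v _ i hi z hz
  by_cases hiA : i ∈ A
  · exact key A v i hi hiA z hz
  · rw [← samplingWinners_compl] at hi ⊢
    exact key Aᶜ v i hi (by simpa using hiA) z hz

/-- The richer side can share the target `r`: it has at least `m` winners, none of whom could win
with a bid below `r / m`. Any winning deviation stays in the top `k`, so the target is fixed. -/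
theorem bestRevenue_le_revenue (hv : ∀ i, 0 ≤ v i)
    (h : bestRevenue v (topAgents k v ∩ Aᶜ) ≤ bestRevenue v (topAgents k v ∩ A)) :
    bestRevenue v (topAgents k v ∩ Aᶜ)
      ≤ ∑ i ∈ samplingWinners k A v, criticalBid (samplingWinners k A) v i := by
  set r := bestRevenue v (topAgents k v ∩ Aᶜ) with hr
  rcases (bestRevenue_nonneg hv : 0 ≤ r).eq_or_lt with h0 | h0
  · refine h0.symm.le.trans ?_
    exact Finset.sum_nonneg fun i _ => criticalBid_nonneg
  obtain ⟨m, hm1, hm2, hm3⟩ := exists_share hv (exists_share_of_le_bestRevenue h0 h)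
  have hmpos : (0 : ℝ) < m := by exact_mod_cast hm1
  have hsub : costShareWinners v (topAgents k v ∩ A) r ⊆ samplingWinners k A v :=
    Finset.subset_union_left
  calc r = m * (r / m) := by field_simp
    _ ≤ (costShareWinners v (topAgents k v ∩ A) r).card * (r / m) :=
        mul_le_mul_of_nonneg_right (by exact_mod_cast hm2) (by positivity)
    _ = ∑ i ∈ costShareWinners v (topAgents k v ∩ A) r, r / m := by simp
    _ ≤ ∑ i ∈ costShareWinners v (topAgents k v ∩ A) r,
          criticalBid (samplingWinners k A) v i := by
        refine Finset.sum_le_sum fun i hi => le_criticalBid hv (hsub hi) fun z hz hiz => ?_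
        have hiTA := Finset.mem_inter.1 (costShareWinners_subset hi)
        rw [mem_samplingWinners_update_of_mem hiTA.2 hiTA.1 (samplingWinners_subset hiz)] at hiz
        rw [div_le_iff₀ hmpos, mul_comm]
        exact hm3 i hi z hz hiz
    _ ≤ _ := Finset.sum_le_sum_of_subset_of_nonneg hsub fun i _ _ => criticalBid_nonneg

/-- The revenue is at least the smaller one of the best revenues of the two sides. -/
theorem min_bestRevenue_le_revenue (hv : ∀ i, 0 ≤ v i) :
    min (bestRevenue v (topAgents k v ∩ A)) (bestRevenue v (topAgents k v ∩ Aᶜ))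
      ≤ ∑ i ∈ samplingWinners k A v, criticalBid (samplingWinners k A) v i := by
  rcases le_total (bestRevenue v (topAgents k v ∩ Aᶜ)) (bestRevenue v (topAgents k v ∩ A)) with
    h | h
  · exact (min_le_right _ _).trans (bestRevenue_le_revenue hv h)
  · refine (min_le_left _ _).trans ?_
    have hfun : samplingWinners k Aᶜ = samplingWinners k A := funext fun v => samplingWinners_compl
    have := bestRevenue_le_revenue (k := k) (A := Aᶜ) hv (by simpa using h)
    rwa [hfun, compl_compl] at this

open Finset in
-- At the price `p`, the `(a + 1)`-st highest value, each side sells at least to its members among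
-- the top `a + 1`.
theorem mul_min_card_le_revenue (hv : ∀ i, 0 ≤ v i) {a : ℕ} (hak : a + 1 ≤ k) (ha : a < n) :
    sortDecreasing v ⟨a, ha⟩ *
        (min #(topAgents (a + 1) v ∩ A) #(topAgents (a + 1) v \ A) : ℕ)
      ≤ ∑ i ∈ samplingWinners k A v, criticalBid (samplingWinners k A) v i := by
  set p := sortDecreasing v ⟨a, ha⟩ with hp
  have hp0 : 0 ≤ p := hv _
  have key : ∀ C : Finset (Fin n), p * #(topAgents (a + 1) v ∩ C)
      ≤ bestRevenue v (topAgents k v ∩ C) := by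
    intro C
    refine le_trans ?_ (mul_card_le_bestRevenue hv p)
    refine mul_le_mul_of_nonneg_left ?_ hp0
    refine Nat.cast_le.2 (card_le_card fun i hi => ?_)
    obtain ⟨h1, h2⟩ := mem_inter.1 hi
    exact mem_filter.2 ⟨mem_inter.2 ⟨topAgents_mono hak v h1, h2⟩,
      sortDecreasing_le_of_mem_topAgents ha h1⟩
  refine le_trans (le_min ?_ ?_) (min_bestRevenue_le_revenue (A := A) hv)
  · refine le_trans (mul_le_mul_of_nonneg_left ?_ hp0) (key A)
    exact Nat.cast_le.2 (min_le_left _ _)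
  · refine le_trans (mul_le_mul_of_nonneg_left ?_ hp0) (key Aᶜ)
    rw [← sdiff_eq_inter_compl]
    exact Nat.cast_le.2 (min_le_right _ _)

/-- With a single unit for sale, the revenue is at least the second highest bid. -/
theorem second_le_revenue (hn : 2 ≤ n) (hv : ∀ i, 0 ≤ v i) :
    sortDecreasing v ⟨1, hn⟩
      ≤ ∑ i ∈ samplingWinners 1 A v, criticalBid (samplingWinners 1 A) v i := by
  set σ := Tuple.sort fun i => -v i with hσ
  set i := σ ⟨0, by omega⟩ with hi
  have hout : Outranks v i (σ ⟨1, hn⟩) := (outranks_sort_iff v _ _).2 (by simp [Fin.lt_def])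
  have hiT : i ∈ topAgents 1 v := (sort_mem_topAgents v 1 _).2 (by simp)
  have hT : topAgents 1 v = {i} := by
    obtain ⟨j, hj⟩ := Finset.card_eq_one.1 (card_topAgents (by omega : 1 ≤ n) v)
    rw [hj] at hiT ⊢
    rw [Finset.mem_singleton.1 hiT]
  have key : ∀ A : Finset (Fin n), i ∈ A → i ∈ samplingWinners 1 A v := by
    intro A hiA
    rw [mem_samplingWinners_of_mem hiA, hT]
    have h1 : ({i} : Finset (Fin n)) ∩ Aᶜ = ∅ := by simp [hiA]
    have h2 : ({i} : Finset (Fin n)) ∩ A = {i} := by simp [hiA]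
    -- The other side is empty, so the target is `0` and the single top bidder always wins; the
    -- price comes from having to stay on top.
    have h3 : bestRevenue v ∅ = 0 := by simp [bestRevenue]
    rw [h1, h2, h3]
    refine mem_costShareWinners.2 ⟨Finset.mem_singleton_self _, 1, le_rfl, by simpa using hv i, ?_⟩
    simp [Finset.filter_singleton, hv i]
  have hiW : i ∈ samplingWinners 1 A v := by
    by_cases hiA : i ∈ A
    · exact key A hiA
    · rw [← samplingWinners_compl]
      exact key Aᶜ (by simpa using hiA)
  refine le_trans (le_criticalBid hv hiW fun z _ hiz => ?_)
    (Finset.single_le_sum (f := fun i => criticalBid (samplingWinners 1 A) v i)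
      (fun _ _ => criticalBid_nonneg) hiW)
  have hz := samplingWinners_subset hiz
  rw [mem_topAgents, Nat.lt_one_iff, Finset.card_eq_zero] at hz
  have hne : σ ⟨1, hn⟩ ≠ i := by
    intro h
    have := σ.injective h
    simp at this
  by_contra hlt
  have hmem : σ ⟨1, hn⟩ ∈ Finset.univ.filter fun j => Outranks (Function.update v i z) j i := by
    refine Finset.mem_filter.2 ⟨Finset.mem_univ _, Or.inl ?_⟩
    rw [Function.update_self, Function.update_of_ne hne]
    simpa [sortDecreasing] using hlt
  rw [hz] at hmem
  simp at hmem

end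

/-! ### Splitting a set by fair coins -/

/-- The expectation of the smaller side when `s` and `t` agents are on the two sides and `b`
further agents choose their sides by fair coins. -/
noncomputable def splitMean : ℕ → ℕ → ℕ → ℝ
  | s, t, 0 => min s t
  | s, t, b + 1 => (splitMean (s + 1) t b + splitMean s (t + 1) b) / 2

/-- `min` is superadditive, and tossing the coins of the two groups one by one preserves this. -/
theorem splitMean_superadditive (s t b s' t' b' : ℕ) :
    splitMean s t b + splitMean s' t' b' ≤ splitMean (s + s') (t + t') (b + b') := by
  induction b generalizing s t with
  | zero =>
    rw [Nat.zero_add]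
    induction b' generalizing s' t' with
    | zero =>
      simp only [splitMean]
      have : min s t + min s' t' ≤ min (s + s') (t + t') := by omega
      exact_mod_cast this
    | succ b' ih =>
      have h1 := ih (s' + 1) t'
      have h2 := ih s' (t' + 1)
      simp only [splitMean] at h1 h2 ⊢
      simp only [← Nat.add_assoc] at h1 h2
      linarith
  | succ b ih =>
    have h1 := ih (s + 1) t
    have h2 := ih s (t + 1)
    rw [Nat.add_right_comm b 1 b']
    simp only [splitMean] at h1 h2 ⊢
    rw [Nat.add_right_comm s 1 s'] at h1
    rw [Nat.add_right_comm t 1 t'] at h2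
    linarith

theorem splitMean_add (b b' : ℕ) :
    splitMean 0 0 b + splitMean 0 0 b' ≤ splitMean 0 0 (b + b') :=
  splitMean_superadditive 0 0 b 0 0 b'

/-- By superadditivity, blocks of size `m` can be split off until the size lies in `[m, 2m)`. -/
theorem splitMean_ge_of_base {q : ℝ} {m : ℕ} (hm : 1 ≤ m)
    (hbase : ∀ b, m ≤ b → b < 2 * m → q * b ≤ splitMean 0 0 b) :
    ∀ b, m ≤ b → q * b ≤ splitMean 0 0 b := by
  intro b
  induction b using Nat.strong_induction_on with
  | _ b ih =>
    intro hb
    by_cases h : b < 2 * m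
    · exact hbase b hb h
    · have h1 := hbase m le_rfl (by omega)
      have h2 := ih (b - m) (by omega) (by omega)
      have h3 := splitMean_add m (b - m)
      rw [Nat.add_sub_cancel' hb] at h3
      rw [Nat.cast_sub hb] at h2
      linarith

theorem splitMean_two : splitMean 0 0 2 = 1 / 2 := by norm_num [splitMean]
theorem splitMean_three : splitMean 0 0 3 = 3 / 4 := by norm_num [splitMean]

theorem splitMean_ge_quarter {b : ℕ} (hb : 2 ≤ b) : 1 / 4 * (b : ℝ) ≤ splitMean 0 0 b := by
  refine splitMean_ge_of_base (by norm_num) (fun b h1 h2 => ?_) b hb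
  interval_cases b <;> norm_num [splitMean]

theorem splitMean_ge_five_sixteenths {b : ℕ} (hb : 4 ≤ b) :
    5 / 16 * (b : ℝ) ≤ splitMean 0 0 b := by
  refine splitMean_ge_of_base (by norm_num) (fun b h1 h2 => ?_) b hb
  interval_cases b <;> norm_num [splitMean]

theorem splitMean_ge_eleven_thirtyseconds {b : ℕ} (hb : 6 ≤ b) :
    11 / 32 * (b : ℝ) ≤ splitMean 0 0 b := by
  refine splitMean_ge_of_base (by norm_num) (fun b h1 h2 => ?_) b hb
  interval_cases b <;> norm_num [splitMean]

theorem splitMean_nonneg (s t b : ℕ) : 0 ≤ splitMean s t b := by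
  induction b generalizing s t with
  | zero => simp only [splitMean]; exact_mod_cast Nat.zero_le _
  | succ b ih =>
    simp only [splitMean]
    linarith [ih (s + 1) t, ih s (t + 1)]

/-! ### Averages over uniformly random splits -/

open Finset in
/-- The number of agents on the smaller side when `A` splits `S`. -/
def smallerSide {n : ℕ} (S A : Finset (Fin n)) : ℕ := min #(S ∩ A) #(S \ A)

/-- The average over all subsets of the set of agents. -/
noncomputable def subsetMean {n : ℕ} (F : Finset (Fin n) → ℝ) : ℝ :=
  (∑ A, F A) / 2 ^ n

section

variable {n : ℕ}

theorem subsetMean_mono {F G : Finset (Fin n) → ℝ} (h : ∀ A, F A ≤ G A) :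
    subsetMean F ≤ subsetMean G :=
  div_le_div_of_nonneg_right (Finset.sum_le_sum fun A _ => h A) (by positivity)

theorem subsetMean_add (F G : Finset (Fin n) → ℝ) :
    subsetMean (fun A => F A + G A) = subsetMean F + subsetMean G := by
  simp [subsetMean, Finset.sum_add_distrib, add_div]

theorem subsetMean_const_mul (c : ℝ) (F : Finset (Fin n) → ℝ) :
    subsetMean (fun A => c * F A) = c * subsetMean F := by
  simp [subsetMean, ← Finset.mul_sum, mul_div_assoc]

theorem subsetMean_const (c : ℝ) : subsetMean (n := n) (fun _ => c) = c := by
  simp [subsetMean, Fintype.card_finset]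

open Finset in
/-- An average over all subsets can be taken by flipping the membership of one agent. -/
theorem subsetMean_eq_flip (i : Fin n) (F : Finset (Fin n) → ℝ) :
    subsetMean F = subsetMean fun A => (F (insert i A) + F (A.erase i)) / 2 := by
  have hinv : Function.Involutive fun A : Finset (Fin n) => symmDiff A {i} := fun A => by
    simp only
    rw [symmDiff_assoc, symmDiff_self, symmDiff_bot]
  have h1 : ∑ A, F (symmDiff A {i}) = ∑ A, F A :=
    Fintype.sum_bijective _ hinv.bijective _ _ fun _ => rfl
  have h2 : ∀ A : Finset (Fin n), F (insert i A) + F (A.erase i) = F A + F (symmDiff A {i}) := by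
    intro A
    by_cases hi : i ∈ A
    · have : symmDiff A {i} = A.erase i := by
        ext j; by_cases hj : j = i <;> simp [mem_symmDiff, hj, hi]
      rw [this, insert_eq_of_mem hi]
    · have : symmDiff A {i} = insert i A := by
        ext j; by_cases hj : j = i <;> simp [mem_symmDiff, hj, hi]
      rw [this, erase_eq_of_notMem hi, add_comm]
  unfold subsetMean
  congr 1
  simp only [h2, ← sum_div, sum_add_distrib, h1]
  ring

open Finset in
-- Conditioning on the side of one agent of `S` at a time reproduces the recursion of `splitMean`;
-- `G` ignores these agents and factors out.
theorem subsetMean_mul_min (S : Finset (Fin n)) (G : Finset (Fin n) → ℝ)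
    (hG : ∀ A, ∀ i ∈ S, G (insert i A) = G A ∧ G (A.erase i) = G A) (s t : ℕ) :
    subsetMean (fun A => G A * (min (s + #(S ∩ A)) (t + #(S \ A)) : ℕ))
      = subsetMean G * splitMean s t #S := by
  induction S using Finset.induction_on generalizing s t with
  | empty =>
    simp only [empty_inter, empty_sdiff, card_empty, add_zero, splitMean]
    simp only [mul_comm (G _), subsetMean_const_mul]
    push_cast
    ring
  | insert i S hi ih =>
    have hG' : ∀ A, ∀ j ∈ S, G (insert j A) = G A ∧ G (A.erase j) = G A :=
      fun A j hj => hG A j (mem_insert_of_mem hj)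
    rw [subsetMean_eq_flip i, card_insert_of_notMem hi]
    have h1 := ih hG' (s + 1) t
    have h2 := ih hG' s (t + 1)
    have e1 : ∀ A : Finset (Fin n), #(insert i S ∩ insert i A) = #(S ∩ A) + 1 := by
      intro A
      rw [← insert_inter_distrib, card_insert_of_notMem (by simp [hi])]
    have e2 : ∀ A : Finset (Fin n), #(insert i S \ insert i A) = #(S \ A) := by
      intro A
      congr 1
      ext j
      by_cases hj : j = i <;> simp [hj, hi]
    have e3 : ∀ A : Finset (Fin n), #(insert i S ∩ A.erase i) = #(S ∩ A) := by
      intro A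
      congr 1
      ext j
      by_cases hj : j = i <;> simp [hj, hi]
    have e4 : ∀ A : Finset (Fin n), #(insert i S \ A.erase i) = #(S \ A) + 1 := by
      intro A
      rw [← card_insert_of_notMem (s := S \ A) (a := i) (by simp [hi])]
      congr 1
      ext j
      by_cases hj : j = i <;> simp [hj]
    have e5 : ∀ A, G (insert i A) = G A ∧ G (A.erase i) = G A :=
      fun A => hG A i (mem_insert_self _ _)
    have e6 : (fun A : Finset (Fin n) =>
        (G (insert i A) * ((min (s + #(insert i S ∩ insert i A))
            (t + #(insert i S \ insert i A)) : ℕ) : ℝ)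
          + G (A.erase i) * ((min (s + #(insert i S ∩ A.erase i))
            (t + #(insert i S \ A.erase i)) : ℕ) : ℝ)) / 2)
        = fun A => 1 / 2 * (G A * ((min (s + 1 + #(S ∩ A)) (t + #(S \ A)) : ℕ) : ℝ)
          + G A * ((min (s + #(S ∩ A)) (t + 1 + #(S \ A)) : ℕ) : ℝ)) := by
      funext A
      rw [(e5 A).1, (e5 A).2, e1, e2, e3, e4, add_right_comm s 1, add_right_comm t 1]
      simp only [← add_assoc]
      ring
    rw [e6, subsetMean_const_mul, subsetMean_add, h1, h2]
    simp only [splitMean]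
    ring

theorem subsetMean_smallerSide (S : Finset (Fin n)) :
    subsetMean (fun A => (smallerSide S A : ℝ)) = splitMean 0 0 S.card := by
  have := subsetMean_mul_min S (fun _ => 1) (fun _ _ _ => ⟨rfl, rfl⟩) 0 0
  simpa [subsetMean_const, smallerSide] using this

/-- Disjoint sets are split independently. For two or three agents in `T`, the first factor is the
indicator that they all land on one side. -/
theorem subsetMean_mul_smallerSide {S T : Finset (Fin n)} (h : Disjoint T S) :
    subsetMean (fun A => (1 - (smallerSide T A : ℝ)) * smallerSide S A)
      = (1 - splitMean 0 0 T.card) * splitMean 0 0 S.card := by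
  have hG : ∀ A, ∀ i ∈ S, (1 - (smallerSide T (insert i A) : ℝ)) = 1 - (smallerSide T A : ℝ) ∧
      (1 - (smallerSide T (A.erase i) : ℝ)) = 1 - (smallerSide T A : ℝ) := by
    intro A i hi
    have hiT : i ∉ T := Finset.disjoint_right.1 h hi
    have h1 : T ∩ insert i A = T ∩ A := by
      ext j; by_cases hj : j = i <;> simp [hj, hiT]
    have h2 : T \ insert i A = T \ A := by
      ext j; by_cases hj : j = i <;> simp [hj, hiT]
    have h3 : T ∩ A.erase i = T ∩ A := by
      ext j; by_cases hj : j = i <;> simp [hj, hiT]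
    have h4 : T \ A.erase i = T \ A := by
      ext j; by_cases hj : j = i <;> simp [hj, hiT]
    simp only [smallerSide, h1, h2, h3, h4, and_self]
  have := subsetMean_mul_min S (fun A => 1 - (smallerSide T A : ℝ)) hG 0 0
  have hmean : subsetMean (fun A => 1 - (smallerSide T A : ℝ)) = 1 - splitMean 0 0 T.card := by
    have h1 := subsetMean_add (n := n) (fun _ => 1) (fun A => -1 * (smallerSide T A : ℝ))
    rw [subsetMean_const_mul, subsetMean_const, subsetMean_smallerSide] at h1
    simpa [sub_eq_add_neg] using h1
  rw [hmean] at this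
  simpa [smallerSide] using this

open Finset in
/-- A random split of nested sets `T ⊆ S` with `a ≤ k` agents recovers, in expectation, the
fraction `1 / 6.24` of `a V + (k - a) U`. -/
theorem le_subsetMean_split {S T : Finset (Fin n)} (hTS : T ⊆ S) (hT : #T = 0 ∨ 2 ≤ #T)
    (hS : 2 ≤ #S) {U V : ℝ} (hU : 0 ≤ U) (hUV : U ≤ V) {F : Finset (Fin n) → ℝ}
    (hFU : ∀ A, U * smallerSide S A ≤ F A) (hFV : ∀ A, V * smallerSide T A ≤ F A) :
    #T * V + (#S - #T) * U ≤ 6.24 * subsetMean F := by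
  have meanU : U * splitMean 0 0 #S ≤ subsetMean F := by
    rw [← subsetMean_smallerSide, ← subsetMean_const_mul]
    exact subsetMean_mono hFU
  have meanV : V * splitMean 0 0 #T ≤ subsetMean F := by
    rw [← subsetMean_smallerSide, ← subsetMean_const_mul]
    exact subsetMean_mono hFV
  obtain ⟨a, ha⟩ : ∃ a, a = #T := ⟨_, rfl⟩
  obtain ⟨b, hb⟩ : ∃ b, b = #(S \ T) := ⟨_, rfl⟩
  have hS' : #S = a + b := by rw [ha, hb, add_comm, card_sdiff_add_card_eq_card hTS]
  have hV : 0 ≤ V := hU.trans hUV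
  rw [hS'] at meanU hS ⊢
  rw [← ha] at meanV hT ⊢
  push_cast
  rw [add_sub_cancel_left]
  have hb0 : (0 : ℝ) ≤ b := Nat.cast_nonneg _
  have ha0 : (0 : ℝ) ≤ a := Nat.cast_nonneg _
  -- two or three agents on top: at most one of them is on the smaller side
  have mixed : a = 2 ∨ a = 3 →
      V * splitMean 0 0 a + U * ((1 - splitMean 0 0 a) * splitMean 0 0 b) ≤ subsetMean F := by
    intro h23
    rw [ha, hb, ← subsetMean_smallerSide, ← subsetMean_const_mul, subsetMean_smallerSide,
      ← subsetMean_mul_smallerSide disjoint_sdiff, ← subsetMean_const_mul, ← subsetMean_add]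
    refine subsetMean_mono fun A => ?_
    have hle : smallerSide T A ≤ 1 := by
      have : #(T ∩ A) + #(T \ A) = #T := card_inter_add_card_sdiff T A
      unfold smallerSide
      omega
    have hmono : smallerSide (S \ T) A ≤ smallerSide S A :=
      min_le_min (card_le_card (inter_subset_inter_right sdiff_subset))
        (card_le_card (sdiff_subset_sdiff sdiff_subset le_rfl))
    rcases Nat.le_one_iff_eq_zero_or_eq_one.1 hle with h0 | h1
    · rw [h0]
      have : U * (smallerSide (S \ T) A : ℝ) ≤ U * smallerSide S A :=
        mul_le_mul_of_nonneg_left (by exact_mod_cast hmono) hU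
      have := hFU A
      push_cast
      linarith
    · have := hFV A
      rw [h1] at this ⊢
      push_cast at this ⊢
      linarith
  have hUb : 0 ≤ U * b := mul_nonneg hU hb0
  rcases hT with h0 | h2
  · subst h0
    have := mul_le_mul_of_nonneg_left (splitMean_ge_quarter hS) hU
    push_cast at this meanU ⊢
    linarith
  rcases Nat.eq_zero_or_pos b with hb0' | hbpos
  · subst hb0'
    have := mul_le_mul_of_nonneg_left (splitMean_ge_quarter h2) hV
    have : 0 ≤ V * a := mul_nonneg hV ha0
    push_cast
    linarith
  -- With `R` the mean of `F`: `a V ≤ 3.2 R`, and `b U ≤ (32 / 11) R` once `a + b ≥ 6`. The case `b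
  -- = 1` is separate because `a + b` may be 5; there `U ≤ 0.64 R`.
  by_cases h4 : 4 ≤ a
  · have h5 := mul_le_mul_of_nonneg_left (splitMean_ge_five_sixteenths h4) hV
    have hVa : 0 ≤ V * a := mul_nonneg hV ha0
    have hUa : 0 ≤ U * a := mul_nonneg hU ha0
    by_cases hb1 : b = 1
    · subst hb1
      have h6 := mul_le_mul_of_nonneg_left
        (splitMean_ge_five_sixteenths (by omega : 4 ≤ a + 1)) hU
      have : (4 : ℝ) ≤ a := by exact_mod_cast h4
      push_cast at *
      nlinarith
    · have h6 := mul_le_mul_of_nonneg_left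
        (splitMean_ge_eleven_thirtyseconds (by omega : 6 ≤ a + b)) hU
      push_cast at h6
      linarith
  · have h23 : a = 2 ∨ a = 3 := by omega
    have hmix := mixed h23
    rcases h23 with rfl | rfl
    · rw [splitMean_two] at hmix
      by_cases hb1 : b = 1
      · subst hb1
        have h7 : splitMean 0 0 (2 + 1) = 3 / 4 := splitMean_three
        have h8 := mul_nonneg hU (splitMean_nonneg 0 0 1)
        rw [h7] at meanU
        push_cast
        linarith
      · have h6 := mul_le_mul_of_nonneg_left (splitMean_ge_quarter (by omega : 2 ≤ b)) hU
        have h7 := mul_le_mul_of_nonneg_left (splitMean_ge_quarter hS) hU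
        push_cast at h7 ⊢
        linarith
    · rw [splitMean_three] at hmix
      have h7 := mul_le_mul_of_nonneg_left
        (splitMean_ge_five_sixteenths (by omega : 4 ≤ 3 + b)) hU
      -- The constant originates here. The mixed bound gives `3 V ≤ 4 R`, and `h7` gives `b U ≤ 3.2
      -- b / (3 + b) R`, which is `2.24 R` at `b = 7`. From `b = 8` on, the second term of the mixed
      -- bound brings the total down to `6.2 R`.
      by_cases hb7 : b ≤ 7
      · have h8 := mul_nonneg hU (splitMean_nonneg 0 0 b)
        have h9 : U * b ≤ U * 7 := mul_le_mul_of_nonneg_left (by exact_mod_cast hb7) hU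
        push_cast at h7 ⊢
        linarith
      · have h8 := mul_le_mul_of_nonneg_left
          (splitMean_ge_five_sixteenths (by omega : 4 ≤ b)) hU
        push_cast at h7 ⊢
        linarith

end

/-! ### The approximation in environments given by majorization -/

section

variable {n : ℕ}

theorem secondProfile_apply_of_pos (hn : 2 ≤ n) (v : Fin n → ℝ) {j : ℕ} (hj : j < n)
    (h0 : j ≠ 0) : secondProfile hn v ⟨j, hj⟩ = sortDecreasing v ⟨j, hj⟩ := by
  simp [secondProfile, h0]

theorem secondProfile_zero (hn : 2 ≤ n) (v : Fin n → ℝ) :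
    secondProfile hn v ⟨0, by omega⟩ = sortDecreasing v ⟨1, hn⟩ := by
  simp [secondProfile]

theorem secondProfile_antitone (hn : 2 ≤ n) (v : Fin n → ℝ) : Antitone (secondProfile hn v) := by
  intro a b hab
  refine sortDecreasing_antitone v ?_
  rw [Fin.le_def] at hab ⊢
  split_ifs <;> (simp_all; try omega)

theorem secondProfile_nonneg (hn : 2 ≤ n) {v : Fin n → ℝ} (hv : ∀ i, 0 ≤ v i) (i : Fin n) :
    0 ≤ secondProfile hn v i := hv _

/-- The revenue from selling `l` units at the `l`-th value of the profile `u`. -/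
noncomputable def priceRevenue (u : Fin n → ℝ) (l : ℕ) : ℝ := l * extendZero u (l - 1)

theorem priceRevenue_succ (u : Fin n → ℝ) {j : ℕ} (hj : j < n) :
    priceRevenue u (j + 1) = (j + 1 : ℝ) * u ⟨j, hj⟩ := by
  simp [priceRevenue, extendZero_of_lt u hj]

open Finset in
/-- The hull of the single-price revenues at `k` is attained at `k` or between `a < k` and `∞`. -/
theorem concaveHull_priceRevenue_le {u : Fin n → ℝ} (hu : Antitone u) (hu0 : ∀ i, 0 ≤ u i) {k : ℕ}
    (hk : k < n) {c : ℝ} (h0 : (k + 1) * u ⟨k, hk⟩ ≤ c)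
    (hc : ∀ a (ha : a ≤ k), (a + 1 : ℝ) * u ⟨a, ha.trans_lt hk⟩ + (k - a) * u ⟨k, hk⟩ ≤ c) :
    concaveHull n (priceRevenue u) (k + 1) ≤ c := by
  -- The line of slope `u k` with value `c` at `k + 1`. Points to the left lie below it by `hc`;
  -- those to the right because `u` decreases and the intercept is non-negative.
  have h1 := concaveHull_le (n := n) (R := priceRevenue u) (α := c - (k + 1) * u ⟨k, hk⟩)
    (β := u ⟨k, hk⟩) (by linarith) (hu0 _) ?_ (k + 1)
  · push_cast at h1
    linarith
  · intro l hl hln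
    obtain ⟨j, rfl⟩ : ∃ j, l = j + 1 := ⟨l - 1, by omega⟩
    rw [priceRevenue_succ u (by omega : j < n)]
    push_cast
    rcases le_total j k with h | h
    · linarith [hc j h]
    · have : u ⟨j, by omega⟩ ≤ u ⟨k, hk⟩ := hu (by simpa [Fin.le_def] using h)
      have := mul_le_mul_of_nonneg_left this (by positivity : (0 : ℝ) ≤ j + 1)
      linarith

open Finset in
theorem le_subsetMean_revenue {v : Fin n → ℝ} (hv : ∀ i, 0 ≤ v i) {k a : ℕ}
    (hk : k < n) (hak : a ≤ k) (ha : 1 ≤ a) :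
    (a + 1 : ℝ) * sortDecreasing v ⟨a, hak.trans_lt hk⟩ + (k - a) * sortDecreasing v ⟨k, hk⟩
      ≤ 6.24 * subsetMean fun A =>
        ∑ i ∈ samplingWinners (k + 1) A v, criticalBid (samplingWinners (k + 1) A) v i := by
  have hT : #(topAgents (a + 1) v) = a + 1 := card_topAgents (by omega) v
  have hS : #(topAgents (k + 1) v) = k + 1 := card_topAgents (by omega) v
  have := le_subsetMean_split (topAgents_mono (by omega : a + 1 ≤ k + 1) v) (by omega) (by omega)
    (U := sortDecreasing v ⟨k, hk⟩) (V := sortDecreasing v ⟨a, hak.trans_lt hk⟩) (hv _)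
    (sortDecreasing_antitone v (by simpa [Fin.le_def] using hak))
    (fun A => mul_min_card_le_revenue (A := A) hv le_rfl hk)
    (fun A => mul_min_card_le_revenue (A := A) hv (by omega) (by omega))
  rw [hT, hS] at this
  push_cast at this
  linarith

/-- For `k + 1` units, random sampling profit extraction recovers the concave hull. -/
theorem concaveHull_le_subsetMean_revenue (hn : 2 ≤ n) {v : Fin n → ℝ} (hv : ∀ i, 0 ≤ v i) {k : ℕ}
    (hk : k < n) :
    concaveHull n (priceRevenue (secondProfile hn v)) (k + 1)
      ≤ 6.24 * subsetMean fun A =>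
        ∑ i ∈ samplingWinners (k + 1) A v, criticalBid (samplingWinners (k + 1) A) v i := by
  have hu := secondProfile_antitone hn v
  have hu0 := secondProfile_nonneg hn hv
  rcases Nat.eq_zero_or_pos k with rfl | hkpos
  · have h1 : sortDecreasing v ⟨1, hn⟩ ≤ subsetMean fun A =>
        ∑ i ∈ samplingWinners (0 + 1) A v, criticalBid (samplingWinners (0 + 1) A) v i := by
      rw [← subsetMean_const (n := n) (sortDecreasing v ⟨1, hn⟩)]
      exact subsetMean_mono fun A => second_le_revenue hn hv
    have h2 : 0 ≤ sortDecreasing v ⟨1, hn⟩ := hv _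
    refine concaveHull_priceRevenue_le hu hu0 hk ?_ fun a ha => ?_
    · rw [secondProfile_zero hn v]
      push_cast
      linarith
    · obtain rfl : a = 0 := by omega
      rw [secondProfile_zero hn v]
      push_cast
      linarith
  · have hsk : secondProfile hn v ⟨k, hk⟩ = sortDecreasing v ⟨k, hk⟩ :=
      secondProfile_apply_of_pos hn v hk (by omega)
    have hmain := fun a (hak : a ≤ k) (ha : 1 ≤ a) => le_subsetMean_revenue hv hk hak ha
    have h1 : sortDecreasing v ⟨k, hk⟩ ≤ sortDecreasing v ⟨1, hn⟩ :=
      sortDecreasing_antitone v (by simp only [Fin.le_def]; omega)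
    refine concaveHull_priceRevenue_le hu hu0 hk ?_ fun a ha => ?_
    · have := hmain k le_rfl hkpos
      rw [hsk]
      linarith
    · rcases Nat.eq_zero_or_pos a with rfl | hapos
      -- The first two entries of the second profile coincide, so selling one unit at the top price
      -- is dominated by selling two.
      · have := hmain 1 hkpos le_rfl
        rw [secondProfile_zero hn v, hsk]
        push_cast at this ⊢
        linarith
      · have := hmain a ha hapos
        rwa [secondProfile_apply_of_pos hn v _ (by omega), hsk]

open Finset in
-- With `j + 1` units at most `min (j + 1) s` agents of a set of size `s` are served; averaging
-- these bounds gives exactly the majorization bound, whence the mixture is feasible.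
theorem sum_weights_mul_min {w : ℕ → ℝ} (hwn : w n = 0) {s : ℕ} (hs : s ≤ n) :
    ∑ j ∈ range n, (w j - w (j + 1)) * (min (j + 1) s : ℕ) = ∑ j ∈ range s, w j := by
  rw [sum_mul_sub_succ w (fun j => ((min j s : ℕ) : ℝ)) (by simp), hwn, zero_mul, sub_zero]
  rw [← sum_subset (range_subset_range.2 hs)]
  · refine sum_congr rfl fun j hj => ?_
    have := mem_range.1 hj
    rw [min_eq_left (by omega), min_eq_left (by omega)]
    push_cast
    ring
  · intro j _ hj
    have : s ≤ j := by simpa using hj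
    rw [min_eq_right (by omega), min_eq_right (by omega)]
    simp

open Finset in
theorem hasPriorFreeApprox_majorizedAllocations (hn : 2 ≤ n) {w : ℕ → ℝ} (hw : Antitone w)
    (hwn : w n = 0) : HasPriorFreeApprox hn (majorizedAllocations w) 6.24 := by
  have hμ : ∀ j, 0 ≤ w j - w (j + 1) := fun j => sub_nonneg.2 (hw (Nat.le_succ j))
  have hw0 : ∀ j ≤ n, 0 ≤ w j := fun j hj => hwn ▸ hw hj
  -- An index is a number of units, less one, together with a split. The total weight is `w 0`,
  -- which need not be 1.
  set c : Fin n × Finset (Fin n) → ℝ := fun a => (w a.1 - w (a.1 + 1)) / 2 ^ n with hc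
  have hc0 : ∀ a, 0 ≤ c a := fun a => div_nonneg (hμ _) (by positivity)
  set W : Fin n × Finset (Fin n) → (Fin n → ℝ) → Finset (Fin n) :=
    fun a => samplingWinners (a.1 + 1) a.2 with hW
  have hmean : ∀ G : ℕ → Finset (Fin n) → ℝ, ∑ a : Fin n × Finset (Fin n), c a * G a.1 a.2
      = ∑ j ∈ range n, (w j - w (j + 1)) * subsetMean (G j) := by
    intro G
    rw [Fintype.sum_prod_type,
      ← Fin.sum_univ_eq_sum_range (fun j => (w j - w (j + 1)) * subsetMean (G j))]
    refine sum_congr rfl fun j _ => ?_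
    simp only [hc, subsetMean]
    rw [← mul_sum]
    ring
  refine ⟨ruleMechanism c W, ?_,
    ruleMechanism_isIncentiveCompatible hc0 fun a => samplingWinners_isMonotoneRule _ _,
    ruleMechanism_isIR hc0, ruleMechanism_hasNonnegPayments hc0, ?_⟩
  · intro v _
    refine ⟨fun i => sum_nonneg fun a _ => mul_nonneg (hc0 a) ?_, fun S => ?_⟩
    · unfold charVec
      split_ifs <;> norm_num
    · have hcard : #S ≤ n := by simpa using card_le_univ S
      have h1 : ∑ i ∈ S, (ruleMechanism c W).alloc v i
          = ∑ a : Fin n × Finset (Fin n), c a * (#(W a v ∩ S) : ℝ) := by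
        simp only [ruleMechanism]
        rw [sum_comm]
        refine sum_congr rfl fun a _ => ?_
        rw [← mul_sum]
        simp only [charVec, sum_boole]
        rw [filter_mem_eq_inter, inter_comm]
      rw [h1, ← sum_weights_mul_min hwn hcard]
      refine (sum_le_sum fun a _ => mul_le_mul_of_nonneg_left
        (?_ : (#(W a v ∩ S) : ℝ) ≤ (min ((a.1 : ℕ) + 1) #S : ℕ)) (hc0 a)).trans ?_
      · refine Nat.cast_le.2 (le_min ?_ (card_le_card inter_subset_right))
        rw [← card_topAgents (show (a.1 : ℕ) + 1 ≤ n from a.1.2) v]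
        exact card_le_card (inter_subset_left.trans samplingWinners_subset)
      · rw [hmean fun j _ => ((min (j + 1) #S : ℕ) : ℝ)]
        simp only [subsetMean_const, le_refl]
  · intro v hv
    set B := concaveHull n (priceRevenue (secondProfile hn v)) with hB
    refine csSup_le (nonempty_envyFreeRevenues ⟨fun i => le_rfl, fun S => ?_⟩) ?_
    · have hcard : #S ≤ n := by simpa using card_le_univ S
      simp only [Pi.zero_apply, sum_const_zero]
      exact sum_nonneg fun j hj => hw0 j ((mem_range.1 hj).le.trans hcard)
    · rintro r ⟨x, p, hx, hef, hir, rfl⟩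
      have h1 := hef.sum_pay_le (B := B) (secondProfile_antitone hn v) hx hir
        (concaveHull_zero _ _) (fun j _ => concaveHull_le_succ _ _ j)
        (fun j _ => concaveHull_concave _ _ j) (fun i => by
          rw [← priceRevenue_succ _ i.2]
          exact self_le_concaveHull _ (by omega) i.2)
      have h2 := sum_mul_sub_succ w B (concaveHull_zero _ _) n
      rw [hwn, zero_mul, sub_zero] at h2
      refine h1.trans ?_
      rw [← h2, ruleMechanism_revenue, hmean fun j A =>
        ∑ i ∈ samplingWinners (j + 1) A v, criticalBid (samplingWinners (j + 1) A) v i, mul_sum]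
      refine sum_le_sum fun j hj => ?_
      have := mul_le_mul_of_nonneg_left
        (concaveHull_le_subsetMean_revenue hn hv (mem_range.1 hj)) (hμ j)
      linarith

end

/-! ### The environments are given by majorization -/

section

variable {n : ℕ}

theorem convex_setOf_sum_le (φ : Finset (Fin n) → ℝ) :
    Convex ℝ {x : Fin n → ℝ | (∀ i, 0 ≤ x i) ∧ ∀ S : Finset (Fin n), ∑ i ∈ S, x i ≤ φ S} := by
  intro x hx y hy a b ha hb hab
  refine ⟨fun i => ?_, fun S => ?_⟩
  · simp only [Pi.add_apply, Pi.smul_apply, smul_eq_mul]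
    exact add_nonneg (mul_nonneg ha (hx.1 i)) (mul_nonneg hb (hy.1 i))
  · simp only [Pi.add_apply, Pi.smul_apply, smul_eq_mul, Finset.sum_add_distrib, ← Finset.mul_sum]
    calc a * ∑ i ∈ S, x i + b * ∑ i ∈ S, y i ≤ a * φ S + b * φ S :=
          add_le_add (mul_le_mul_of_nonneg_left (hx.2 S) ha)
            (mul_le_mul_of_nonneg_left (hy.2 S) hb)
      _ = φ S := by rw [← add_mul, hab, one_mul]

open Finset in
/-- A closed convex set that contains all the vertices of the majorized allocations contains all
majorized allocations. -/
theorem majorizedAllocations_subset {X : Set (Fin n → ℝ)} (hconv : Convex ℝ X)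
    (hclosed : IsClosed X) {w : ℕ → ℝ}
    (hvert : ∀ (σ : Equiv.Perm (Fin n)) (m : ℕ), m ≤ n →
      ∃ y ∈ X, ∀ j : Fin n, y (σ j) = if (j : ℕ) < m then w j else 0) :
    majorizedAllocations w ⊆ X := by
  intro x hx
  by_contra hxX
  obtain ⟨f, u, hfu, hux⟩ := geometric_hahn_banach_closed_point hconv hclosed hxX
  set c : Fin n → ℝ := fun i => f (Pi.single i 1) with hc
  have hf : ∀ z : Fin n → ℝ, f z = ∑ i, z i * c i := by
    intro z
    have := LinearMap.pi_apply_eq_sum_univ (f : (Fin n → ℝ) →ₗ[ℝ] ℝ) z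
    simp only [ContinuousLinearMap.coe_coe, smul_eq_mul] at this
    rw [this]
    refine sum_congr rfl fun i _ => ?_
    rw [hc]
    congr 2
    ext j
    simp [Pi.single_apply, eq_comm]
  set σ := Tuple.sort fun i => -c i with hσ
  have hanti : Antitone (c ∘ σ) := fun a b hab => by
    have := Tuple.monotone_sort (fun i => -c i) hab
    simp only [Function.comp] at this ⊢
    linarith
  -- Greedy maximization: positions go to agents in order of decreasing coefficient, and only to
  -- positive coefficients. Abel summation against `max c 0` shows that no majorized vector does
  -- better.
  set m := #{j : Fin n | 0 < c (σ j)} with hm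
  have hmn : m ≤ n := by simpa using card_le_univ ({j : Fin n | 0 < c (σ j)} : Finset (Fin n))
  obtain ⟨y, hyX, hy⟩ := hvert σ m hmn
  have hlt : ∀ j : Fin n, (j : ℕ) < m ↔ 0 < c (σ j) := by
    intro j
    exact Tuple.lt_card_gt_iff_apply_gt_of_antitone (f := c ∘ σ) (a := 0) (j := j) hanti
  set b : Fin n → ℝ := fun j => max (c (σ j)) 0 with hb
  have hab : 0 ≤ ∑ j ∈ range n, (w j - extendZero (x ∘ σ) j) * extendZero b j := by
    refine sum_mul_nonneg_of_antitone (fun j hj => ?_) (fun j hj => ?_) fun k hk => ?_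
    · rw [extendZero_of_lt _ hj, extendZero_of_lt _ (by omega)]
      exact max_le_max (hanti (by simp [Fin.le_def])) le_rfl
    · rw [extendZero_of_lt _ hj]
      exact le_max_right _ _
    · rw [sum_sub_distrib]
      exact sub_nonneg.2 (sum_range_extendZero_le hx σ hk)
  rw [← Fin.sum_univ_eq_sum_range
    (fun j => (w j - extendZero (x ∘ σ) j) * extendZero b j)] at hab
  have hfy : f y = ∑ j : Fin n, w j * b j := by
    rw [hf, ← Equiv.sum_comp σ]
    refine sum_congr rfl fun j _ => ?_
    rw [hy, hb]
    simp only
    split_ifs with h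
    · rw [max_eq_left ((hlt j).1 h).le]
    · rw [max_eq_right (not_lt.1 fun h' => h ((hlt j).2 h'))]
      simp
  have hfx : f x ≤ ∑ j : Fin n, x (σ j) * b j := by
    rw [hf, ← Equiv.sum_comp σ]
    exact sum_le_sum fun j _ => mul_le_mul_of_nonneg_left (le_max_left _ _) (hx.1 _)
  have hxy : ∑ j : Fin n, x (σ j) * b j ≤ ∑ j : Fin n, w j * b j := by
    rw [← sub_nonneg, ← sum_sub_distrib]
    refine hab.trans_eq (sum_congr rfl fun j _ => ?_)
    rw [extendZero_of_lt _ j.2, extendZero_of_lt _ j.2]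
    simp only [Function.comp, Fin.eta]
    ring
  have := hfu y hyX
  linarith

theorem servingAllocations_convex (F : Set (Finset (Fin n))) :
    Convex ℝ (servingAllocations F) := convex_convexHull ℝ _

theorem servingAllocations_isCompact (F : Set (Finset (Fin n))) :
    IsCompact (servingAllocations F) := (Set.toFinite _).isCompact_convexHull ℝ

theorem charVec_nonneg (S : Finset (Fin n)) (i : Fin n) : 0 ≤ charVec S i := by
  unfold charVec
  split_ifs <;> norm_num

open Finset in
theorem sum_charVec (S T : Finset (Fin n)) : ∑ i ∈ T, charVec S i = #(T ∩ S) := by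
  simp only [charVec, sum_boole]
  rw [filter_mem_eq_inter]

/-! #### Multi-unit environments -/

/-- The service probabilities at the positions of a multi-unit environment. -/
noncomputable def unitWeights (n k : ℕ) (j : ℕ) : ℝ := if j < k ∧ j < n then 1 else 0

theorem unitWeights_antitone (n k : ℕ) : Antitone (unitWeights n k) := by
  intro a b hab
  unfold unitWeights
  split_ifs with h1 h2
  · rfl
  · exact absurd ⟨by omega, by omega⟩ h2
  · norm_num
  · rfl

open Finset in
theorem sum_unitWeights (k : ℕ) {s : ℕ} (hs : s ≤ n) :
    ∑ j ∈ range s, unitWeights n k j = (min s k : ℕ) := by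
  have : ∀ j ∈ range s, unitWeights n k j = if j < k then 1 else 0 := by
    intro j hj
    have := mem_range.1 hj
    simp [unitWeights, show j < n by omega]
  rw [sum_congr rfl this, sum_boole]
  congr 1
  have h2 : (range s).filter (fun j => j < k) = range (min s k) := by
    ext j
    simp
  rw [h2, card_range]

open Finset in
theorem multiUnit_eq_majorizedAllocations (n k : ℕ) :
    servingAllocations (multiUnitSystem n k) = majorizedAllocations (unitWeights n k) := by
  refine Set.Subset.antisymm (convexHull_min ?_ (convex_setOf_sum_le _))
    (majorizedAllocations_subset (servingAllocations_convex _)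
      (servingAllocations_isCompact _).isClosed fun σ m hm => ?_)
  · rintro _ ⟨S, hS, rfl⟩
    refine ⟨charVec_nonneg S, fun T => ?_⟩
    rw [sum_charVec, sum_unitWeights k (by simpa using card_le_univ T)]
    refine Nat.cast_le.2 (le_min (card_le_card inter_subset_left) ?_)
    exact (card_le_card inter_subset_right).trans hS
  · set S := (univ.filter fun j : Fin n => (j : ℕ) < min m k).map σ.toEmbedding with hS
    have hcard : #S = min m k := card_map_perm_initial σ (by omega)
    refine ⟨charVec S, subset_convexHull ℝ _ ⟨S, ?_, rfl⟩, fun j => ?_⟩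
    · change #S ≤ k
      omega
    · have : σ j ∈ S ↔ (j : ℕ) < min m k := by simp [hS]
      simp only [charVec, this, unitWeights, lt_min_iff, j.2, and_true]
      by_cases h1 : (j : ℕ) < m <;> by_cases h2 : (j : ℕ) < k <;> simp [h1, h2]

/-! #### Position environments -/

open Finset in
-- The largest element of a set of `s + 1` naturals is at least `s`, so its weight is at most `w s`.
theorem sum_le_sum_range_card {w : ℕ → ℝ} (hw : Antitone w) (J : Finset ℕ) :
    ∑ j ∈ J, w j ≤ ∑ j ∈ range #J, w j := by
  induction J using Finset.induction_on_max with
  | empty => simp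
  | insert a J ha ih =>
    have hnot : a ∉ J := fun h => lt_irrefl _ (ha a h)
    rw [sum_insert hnot, card_insert_of_notMem hnot, sum_range_succ]
    have hcard : #J ≤ a := by
      have : J ⊆ range a := fun j hj => mem_range.2 (ha j hj)
      simpa using card_le_card this
    linarith [hw hcard]

open Finset in
-- `J` is the set of positions held by agents of `S`; injectivity of a partial assignment keeps them
-- distinct.
theorem exists_sum_assignmentVec_eq (w : Fin n → ℝ) (σ : Fin n ≃. Fin n) (S : Finset (Fin n)) :
    ∃ J : Finset (Fin n), (∀ j ∈ J, ∃ i ∈ S, j ∈ σ i) ∧ #J ≤ #S ∧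
      ∑ i ∈ S, assignmentVec w σ i = ∑ j ∈ J, w j := by
  induction S using Finset.induction_on with
  | empty => exact ⟨∅, by simp⟩
  | insert i S hi ih =>
    obtain ⟨J, h1, h2, h3⟩ := ih
    rw [sum_insert hi, card_insert_of_notMem hi, h3]
    rcases h : σ i with _ | j
    · refine ⟨J, fun j hj => ?_, by omega, by simp [assignmentVec, h]⟩
      obtain ⟨l, hl, hl'⟩ := h1 j hj
      exact ⟨l, mem_insert_of_mem hl, hl'⟩
    · have hj : j ∉ J := by
        intro hj
        obtain ⟨l, hl, hl'⟩ := h1 j hj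
        exact hi (σ.inj hl' h ▸ hl)
      refine ⟨insert j J, fun q hq => ?_, ?_, ?_⟩
      · rcases mem_insert.1 hq with rfl | hq
        · exact ⟨i, mem_insert_self _ _, h⟩
        · obtain ⟨l, hl, hl'⟩ := h1 q hq
          exact ⟨l, mem_insert_of_mem hl, hl'⟩
      · rw [card_insert_of_notMem hj]; omega
      · rw [sum_insert hj]; simp [assignmentVec, h]

theorem extendZero_antitone {w : Fin n → ℝ} (hw : Antitone w) (hw0 : ∀ j, 0 ≤ w j) :
    Antitone (extendZero w) := by
  intro a b hab
  by_cases hb : b < n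
  · rw [extendZero_of_lt _ hb, extendZero_of_lt _ (by omega)]
    exact hw hab
  · rw [extendZero_of_le _ (by omega)]
    unfold extendZero
    split_ifs
    exacts [hw0 _, le_rfl]

open Finset in
theorem positionAllocations_eq_majorizedAllocations {w : Fin n → ℝ} (hw : Antitone w)
    (hw0 : ∀ j, 0 ≤ w j) : positionAllocations w = majorizedAllocations (extendZero w) := by
  have hanti := extendZero_antitone hw hw0
  refine Set.Subset.antisymm (convexHull_min ?_ (convex_setOf_sum_le _))
    (majorizedAllocations_subset (convex_convexHull ℝ _) ?_ fun σ m hm => ?_)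
  · rintro _ ⟨σ, rfl⟩
    refine ⟨fun i => ?_, fun S => ?_⟩
    · unfold assignmentVec
      rcases σ i with _ | j
      · exact le_rfl
      · exact hw0 j
    · obtain ⟨J, -, h2, h3⟩ := exists_sum_assignmentVec_eq w σ S
      rw [h3]
      calc ∑ j ∈ J, w j = ∑ j ∈ J.map Fin.valEmbedding, extendZero w j := by
            rw [sum_map]
            exact sum_congr rfl fun j _ => by simp [extendZero]
        _ ≤ ∑ j ∈ range #J, extendZero w j := by
            simpa using sum_le_sum_range_card hanti (J.map Fin.valEmbedding)
        _ ≤ _ := sum_le_sum_of_subset_of_nonneg (range_subset_range.2 h2) fun j _ _ => by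
            unfold extendZero
            split_ifs
            exacts [hw0 _, le_rfl]
  · have : Finite (Fin n ≃. Fin n) := DFunLike.finite _
    exact ((Set.finite_range _).isCompact_convexHull ℝ).isClosed
  · classical
    refine ⟨_, subset_convexHull ℝ _
      -- Agent `σ j` gets position `j` when `j < m` and no position otherwise.
      ⟨σ.symm.toPEquiv.trans (PEquiv.ofSet {j : Fin n | (j : ℕ) < m}), rfl⟩, fun j => ?_⟩
    rw [extendZero_of_lt w j.2]
    by_cases h : (j : ℕ) < m <;>
      simp [assignmentVec, PEquiv.trans, PEquiv.ofSet, Equiv.toPEquiv, h]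

end

section

variable {n : ℕ}

/-! #### Matroid permutation environments -/

/-- The rank of a set of agents. -/
noncomputable def matroidRank (M : Matroid (Fin n)) (S : Finset (Fin n)) : ℕ :=
  (M.eRk S).toNat

theorem coe_matroidRank (M : Matroid (Fin n)) (S : Finset (Fin n)) :
    (matroidRank M S : ℕ∞) = M.eRk S := by
  refine ENat.natCast_toNat ?_
  have := M.eRk_le_encard (S : Set (Fin n))
  rw [Set.encard_coe_eq_coe_finsetCard] at this
  exact ne_top_of_le_ne_top (ENat.natCast_ne_top _) this

theorem matroidRank_mono (M : Matroid (Fin n)) {S T : Finset (Fin n)} (h : S ⊆ T) :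
    matroidRank M S ≤ matroidRank M T := by
  have := M.eRk_mono (Finset.coe_subset.2 h)
  rw [← coe_matroidRank, ← coe_matroidRank] at this
  exact_mod_cast this

theorem matroidRank_empty (M : Matroid (Fin n)) : matroidRank M ∅ = 0 := by
  simp [matroidRank]

theorem card_le_matroidRank {M : Matroid (Fin n)} {I S : Finset (Fin n)}
    (hI : M.Indep (I : Set (Fin n))) (hIS : I ⊆ S) : I.card ≤ matroidRank M S := by
  have := hI.encard_le_eRk_of_subset (Finset.coe_subset.2 hIS)
  rw [← coe_matroidRank, Set.encard_coe_eq_coe_finsetCard] at this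
  exact_mod_cast this

theorem matroidRank_submod (M : Matroid (Fin n)) (S T : Finset (Fin n)) :
    matroidRank M (S ∩ T) + matroidRank M (S ∪ T) ≤ matroidRank M S + matroidRank M T := by
  have := M.eRk_submod (S : Set (Fin n)) T
  rw [← Finset.coe_inter, ← Finset.coe_union] at this
  simp only [← coe_matroidRank] at this
  exact_mod_cast this

open Finset in
/-- The greedy algorithm: an independent set that is a basis of each member of a chain. -/
theorem exists_indep_card_inter_eq (M : Matroid (Fin n)) (C : ℕ → Finset (Fin n))
    (hC : Monotone C) (m : ℕ) :
    ∃ I : Finset (Fin n), M.Indep (I : Set (Fin n)) ∧ I ⊆ C m ∧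
      ∀ l ≤ m, #(I ∩ C l) = matroidRank M (C l) := by
  classical
  have ext : ∀ (J S : Finset (Fin n)), M.Indep (J : Set (Fin n)) → J ⊆ S →
      ∃ I : Finset (Fin n), M.Indep (I : Set (Fin n)) ∧ J ⊆ I ∧ I ⊆ S ∧ #I = matroidRank M S := by
    intro J S hJ hJS
    obtain ⟨I, hI, hJI⟩ := hJ.subset_isBasis'_of_subset (Finset.coe_subset.2 hJS)
    have hcoe : ((I.toFinite.toFinset : Finset (Fin n)) : Set (Fin n)) = I :=
      Set.Finite.coe_toFinset _
    refine ⟨I.toFinite.toFinset, by rw [hcoe]; exact hI.indep, ?_, ?_, ?_⟩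
    · rw [← Finset.coe_subset, hcoe]; exact hJI
    · rw [← Finset.coe_subset, hcoe]; exact hI.subset
    · have := hI.encard_eq_eRk
      rw [← coe_matroidRank, ← hcoe, Set.encard_coe_eq_coe_finsetCard] at this
      exact_mod_cast this
  induction m with
  | zero =>
    obtain ⟨I, h1, -, h3, h4⟩ := ext ∅ (C 0) (by simp) (empty_subset _)
    refine ⟨I, h1, h3, fun l hl => ?_⟩
    obtain rfl : l = 0 := by omega
    rw [inter_eq_left.2 h3, h4]
  | succ m ih =>
    obtain ⟨J, hJ1, hJ2, hJ3⟩ := ih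
    obtain ⟨I, h1, h2, h3, h4⟩ := ext J (C (m + 1)) hJ1 (hJ2.trans (hC (Nat.le_succ m)))
    refine ⟨I, h1, h3, fun l hl => ?_⟩
    rcases hl.lt_or_eq with hl | rfl
    · refine le_antisymm
        (card_le_matroidRank (h1.subset (Finset.coe_subset.2 inter_subset_left))
          inter_subset_right) ?_
      rw [← hJ3 l (by omega)]
      exact card_le_card (inter_subset_inter_right h2)
    · rw [inter_eq_left.2 h3, h4]

/-- The mean rank of a set of agents after a random renaming. -/
noncomputable def meanRank (M : Matroid (Fin n)) (S : Finset (Fin n)) : ℝ :=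
  (∑ π : Equiv.Perm (Fin n), (matroidRank M (S.map π.symm.toEmbedding) : ℝ)) / n.factorial

theorem meanRank_map (M : Matroid (Fin n)) (S : Finset (Fin n)) (ρ : Equiv.Perm (Fin n)) :
    meanRank M (S.map ρ.toEmbedding) = meanRank M S := by
  unfold meanRank
  congr 1
  refine Fintype.sum_equiv (Equiv.mulLeft ρ⁻¹) _ _ fun π => ?_
  rw [Finset.map_map]
  rfl

/-- A bijection between the two sets extends to a permutation of all agents, and the mean over
renamings is invariant under it. -/
theorem meanRank_eq_of_card_eq (M : Matroid (Fin n)) {S T : Finset (Fin n)}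
    (h : S.card = T.card) : meanRank M S = meanRank M T := by
  set e : {x // x ∈ S} ≃ {x // x ∈ T} := Finset.equivOfCardEq h with he
  have hmap : S.map (e.extendSubtype : Equiv.Perm (Fin n)).toEmbedding = T := by
    refine Finset.eq_of_subset_of_card_le (fun x hx => ?_) (by rw [Finset.card_map, h])
    obtain ⟨y, hy, rfl⟩ := Finset.mem_map.1 hx
    exact e.extendSubtype_mem y hy
  rw [← hmap, meanRank_map]

theorem meanRank_mono (M : Matroid (Fin n)) {S T : Finset (Fin n)} (h : S ⊆ T) :
    meanRank M S ≤ meanRank M T :=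
  div_le_div_of_nonneg_right (Finset.sum_le_sum fun _ _ =>
    Nat.cast_le.2 (matroidRank_mono M (Finset.map_subset_map.2 h))) (by positivity)

theorem meanRank_submod (M : Matroid (Fin n)) (S T : Finset (Fin n)) :
    meanRank M (S ∩ T) + meanRank M (S ∪ T) ≤ meanRank M S + meanRank M T := by
  simp only [meanRank, ← add_div, ← Finset.sum_add_distrib]
  refine div_le_div_of_nonneg_right (Finset.sum_le_sum fun π _ => ?_) (by positivity)
  rw [Finset.map_inter, Finset.map_union]
  exact_mod_cast matroidRank_submod M _ _

/-- The first `m` agents. -/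
def initialAgents (n m : ℕ) : Finset (Fin n) := Finset.univ.filter fun j => (j : ℕ) < m

theorem card_initialAgents {m : ℕ} (hm : m ≤ n) : (initialAgents n m).card = m := by
  rw [initialAgents, Fin.card_filter_val_lt]
  omega

theorem initialAgents_mono : Monotone (initialAgents n) := fun a b hab j hj => by
  simp only [initialAgents, Finset.mem_filter, Finset.mem_univ, true_and] at hj ⊢
  omega

/-- The marginal mean ranks: the service probabilities at the positions of a matroid permutation
environment. -/
noncomputable def rankWeights (M : Matroid (Fin n)) (j : ℕ) : ℝ :=
  meanRank M (initialAgents n (j + 1)) - meanRank M (initialAgents n j)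

theorem sum_rankWeights (M : Matroid (Fin n)) (m : ℕ) :
    ∑ j ∈ Finset.range m, rankWeights M j = meanRank M (initialAgents n m) := by
  unfold rankWeights
  rw [Finset.sum_range_sub (fun j => meanRank M (initialAgents n j))]
  simp [initialAgents, meanRank, matroidRank_empty]

theorem rankWeights_eq_zero (M : Matroid (Fin n)) {j : ℕ} (hj : n ≤ j) : rankWeights M j = 0 := by
  have h : ∀ m, n ≤ m → initialAgents n m = Finset.univ := fun m hm =>
    Finset.filter_true_of_mem fun i _ => i.2.trans_le hm
  rw [rankWeights, h _ hj, h _ (by omega), sub_self]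

theorem rankWeights_nonneg (M : Matroid (Fin n)) (j : ℕ) : 0 ≤ rankWeights M j :=
  sub_nonneg.2 (meanRank_mono M (initialAgents_mono (Nat.le_succ j)))

open Finset in
theorem rankWeights_antitone (M : Matroid (Fin n)) : Antitone (rankWeights M) := by
  refine antitone_nat_of_succ_le fun j => ?_
  by_cases hj : j + 1 < n
  -- `T` replaces agent `j` by agent `j + 1` in the first `j + 1` agents, so it has the same mean
  -- rank; submodularity then compares consecutive increments.
  · set T := insert ⟨j + 1, hj⟩ (initialAgents n j) with hT
    have h1 : initialAgents n (j + 1) ∩ T = initialAgents n j := by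
      ext i
      simp only [hT, initialAgents, mem_inter, mem_insert, mem_filter, mem_univ, true_and,
        Fin.ext_iff]
      omega
    have h2 : initialAgents n (j + 1) ∪ T = initialAgents n (j + 2) := by
      ext i
      simp only [hT, initialAgents, mem_union, mem_insert, mem_filter, mem_univ, true_and,
        Fin.ext_iff]
      omega
    have hcard : #T = #(initialAgents n (j + 1)) := by
      rw [hT, card_insert_of_notMem (by simp [initialAgents]), card_initialAgents (by omega),
        card_initialAgents (by omega)]
    have h3 := meanRank_submod M (initialAgents n (j + 1)) T
    rw [h1, h2, meanRank_eq_of_card_eq M hcard] at h3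
    unfold rankWeights
    linarith
  · rw [rankWeights_eq_zero M (by omega)]
    exact rankWeights_nonneg M j

theorem meanRank_eq_sum_rankWeights (M : Matroid (Fin n)) (S : Finset (Fin n)) :
    meanRank M S = ∑ j ∈ Finset.range S.card, rankWeights M j := by
  rw [sum_rankWeights]
  refine meanRank_eq_of_card_eq M ?_
  rw [card_initialAgents (by simpa using S.card_le_univ)]

/-- Averaging over the drawn permutation. -/
noncomputable def permutationMean (n : ℕ) :
    (Equiv.Perm (Fin n) → Fin n → ℝ) →ₗ[ℝ] (Fin n → ℝ) :=
  (n.factorial : ℝ)⁻¹ • ∑ π, LinearMap.proj π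

theorem permutationMean_apply (y : Equiv.Perm (Fin n) → Fin n → ℝ) (i : Fin n) :
    permutationMean n y i = (∑ π, y π i) / n.factorial := by
  simp [permutationMean, LinearMap.sum_apply, Finset.sum_apply, div_eq_inv_mul]

theorem permutationAllocations_eq_image (F : Set (Finset (Fin n))) :
    permutationAllocations F = permutationMean n ''
      Set.pi Set.univ fun π => servingAllocations (permutedSystem F π) := by
  ext x
  constructor
  · rintro ⟨y, hy, hx⟩
    exact ⟨y, fun π _ => hy π, funext fun i => by rw [permutationMean_apply, hx]⟩
  · rintro ⟨y, hy, rfl⟩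
    exact ⟨y, fun π => hy π trivial, fun i => permutationMean_apply y i⟩

theorem permutationAllocations_convex (F : Set (Finset (Fin n))) :
    Convex ℝ (permutationAllocations F) := by
  rw [permutationAllocations_eq_image]
  exact (convex_pi fun π _ => servingAllocations_convex _).linear_image _

theorem permutationAllocations_isClosed (F : Set (Finset (Fin n))) :
    IsClosed (permutationAllocations F) := by
  rw [permutationAllocations_eq_image]
  exact ((isCompact_univ_pi fun π => servingAllocations_isCompact _).image
    (permutationMean n).continuous_of_finiteDimensional).isClosed

open Finset in
theorem sum_le_matroidRank {M : Matroid (Fin n)} {π : Equiv.Perm (Fin n)} {z : Fin n → ℝ}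
    (hz : z ∈ servingAllocations (permutedSystem (matroidSystem M) π)) :
    (∀ i, 0 ≤ z i) ∧
      ∀ T : Finset (Fin n), ∑ i ∈ T, z i ≤ matroidRank M (T.map π.symm.toEmbedding) := by
  refine convexHull_min ?_
    (convex_setOf_sum_le fun T => (matroidRank M (T.map π.symm.toEmbedding) : ℝ)) hz
  rintro _ ⟨_, ⟨S, hS, rfl⟩, rfl⟩
  refine ⟨charVec_nonneg _, fun T => ?_⟩
  rw [sum_charVec]
  refine Nat.cast_le.2 ?_
  have h1 : (T ∩ S.map π.toEmbedding).map π.symm.toEmbedding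
      = T.map π.symm.toEmbedding ∩ S := by
    rw [map_inter, map_map]
    congr 1
    ext i
    simp
  rw [← card_map π.symm.toEmbedding, h1]
  exact card_le_matroidRank
    (Matroid.Indep.subset hS (Finset.coe_subset.2 inter_subset_right)) inter_subset_left

open Finset in
theorem matroidPermutation_eq_majorizedAllocations (M : Matroid (Fin n)) :
    permutationAllocations (matroidSystem M) = majorizedAllocations (rankWeights M) := by
  refine Set.Subset.antisymm ?_ (majorizedAllocations_subset (permutationAllocations_convex _)
    (permutationAllocations_isClosed _) fun σ m hm => ?_)
  · rintro x ⟨y, hy, hx⟩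
    refine ⟨fun i => ?_, fun S => ?_⟩
    · rw [hx]
      exact div_nonneg (sum_nonneg fun π _ => (sum_le_matroidRank (hy π)).1 i) (by positivity)
    · rw [← meanRank_eq_sum_rankWeights, meanRank]
      simp only [hx, ← sum_div]
      rw [sum_comm]
      exact div_le_div_of_nonneg_right
        (sum_le_sum fun π _ => (sum_le_matroidRank (hy π)).2 S) (by positivity)
  -- For each drawn `π`, run the greedy algorithm along the chain of the first agents in the order
  -- `σ`, pulled back by `π`. Serving `π (I π)` then serves each initial segment up to its rank.
  · choose I hI1 hI2 hI3 using fun π : Equiv.Perm (Fin n) =>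
      exists_indep_card_inter_eq M
        (fun l => ((initialAgents n l).map σ.toEmbedding).map π.symm.toEmbedding)
        (fun a b hab => map_subset_map.2 (map_subset_map.2 (initialAgents_mono hab))) m
    have hcount : ∀ π, ∀ l ≤ m, ∑ j ∈ initialAgents n l,
        charVec ((I π).map π.toEmbedding) (σ j)
          = matroidRank M (((initialAgents n l).map σ.toEmbedding).map π.symm.toEmbedding) := by
      intro π l hl
      rw [← hI3 π l hl, ← card_map π.toEmbedding, map_inter, map_map, inter_comm]
      have h1 : (((initialAgents n l).map σ.toEmbedding).map
          (π.symm.toEmbedding.trans π.toEmbedding)) = (initialAgents n l).map σ.toEmbedding := by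
        ext i
        simp
      rw [h1, ← sum_charVec, sum_map]
      rfl
    refine ⟨permutationMean n fun π => charVec ((I π).map π.toEmbedding), ?_, fun j => ?_⟩
    · rw [permutationAllocations_eq_image]
      exact ⟨_, fun π _ => subset_convexHull ℝ _ ⟨_, ⟨I π, hI1 π, rfl⟩, rfl⟩, rfl⟩
    · rw [permutationMean_apply]
      split_ifs with hj
      · have hsucc : initialAgents n (j + 1) = insert j (initialAgents n j) := by
          ext i
          simp only [initialAgents, mem_insert, mem_filter, mem_univ, true_and, Fin.ext_iff]
          omega
        rw [rankWeights, ← meanRank_map M _ σ, ← meanRank_map M (initialAgents n j) σ, meanRank,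
          meanRank, ← sub_div, ← sum_sub_distrib]
        congr 1
        refine sum_congr rfl fun π _ => ?_
        rw [← hcount π _ hj, ← hcount π _ hj.le, hsucc,
          sum_insert (by simp [initialAgents])]
        ring
      · rw [sum_eq_zero, zero_div]
        intro π _
        rw [charVec, if_neg]
        intro hmem
        obtain ⟨i, hi, hij⟩ := mem_map.1 hmem
        have := hI2 π hi
        obtain ⟨q, hq, rfl⟩ := mem_map.1 this
        obtain ⟨t, ht, rfl⟩ := mem_map.1 hq
        simp only [Equiv.coe_toEmbedding, Equiv.apply_symm_apply, EmbeddingLike.apply_eq_iff_eq]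
          at hij
        subst hij
        simp only [initialAgents, mem_filter, mem_univ, true_and] at ht
        exact hj ht

end

end EnvyFree

theorem corollary6p6 (n : ℕ) (hn : 2 ≤ n) :
    (∀ k : ℕ,
      EnvyFree.HasPriorFreeApprox hn
        (EnvyFree.servingAllocations (EnvyFree.multiUnitSystem n k)) 6.24) ∧
    (∀ M : Matroid (Fin n),
      EnvyFree.HasPriorFreeApprox hn
        (EnvyFree.permutationAllocations (EnvyFree.matroidSystem M)) 6.24) ∧
    (∀ w : Fin n → ℝ, Antitone w → (∀ j, 0 ≤ w j ∧ w j ≤ 1) →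
      EnvyFree.HasPriorFreeApprox hn (EnvyFree.positionAllocations w) 6.24) := by
  refine ⟨fun k => ?_, fun M => ?_, fun w hw hw01 => ?_⟩
  · rw [EnvyFree.multiUnit_eq_majorizedAllocations]
    exact EnvyFree.hasPriorFreeApprox_majorizedAllocations hn
      -- The clause `j < n` in `unitWeights` makes the weight at `n` vanish even if `k > n`.
      (EnvyFree.unitWeights_antitone n k) (by simp [EnvyFree.unitWeights])
  · rw [EnvyFree.matroidPermutation_eq_majorizedAllocations]
    exact EnvyFree.hasPriorFreeApprox_majorizedAllocations hn
      (EnvyFree.rankWeights_antitone M) (EnvyFree.rankWeights_eq_zero M le_rfl)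
  · rw [EnvyFree.positionAllocations_eq_majorizedAllocations hw fun j => (hw01 j).1]
    exact EnvyFree.hasPriorFreeApprox_majorizedAllocations hn
      (EnvyFree.extendZero_antitone hw fun j => (hw01 j).1) (EnvyFree.extendZero_of_le w le_rfl)
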